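/- Conventions. All manifolds, forms and diffeomorphisms are of class $C^\infty$; manifolds are finite dimensional and without boundary; $H^q(M)=H^q(M,\mathbb R)$ is de Rham cohomology. For a group $G$ and a right $G$-module $A$ let $C^p(G,A)$ be the set of maps $G^p\to A$ ($C^0(G,A)=A$), with the differential $$(Df)(g_1,\dots,g_{p+1})=f(g_2,\dots,g_{p+1})+\sum_{i=1}^p(-1)^if(g_1,\dots,g_ig_{i+1},\dots,g_{p+1})+(-1)^{p+1}f(g_1,\dots,g_p)\cdot g_{p+1}.$$ Let $G$ be a group of diffeomorphisms of a connected manifold $N$. It acts on the right on the forms $\Omega^q(N)$ by pull back. On $C^p(G,\Omega^q(N))$ write $\delta'$ for the above differential and put $\delta''c=(-1)^p\,d\circ c$. Let $\omega$ be a $G$-invariant exact $m$-form on $N$, $m\ge1$, and let $H^1(N)=\dots=H^{m-1}(N)=0$. Choose cochains $\varphi_{i,m-i-1}\in C^i(G,\Omega^{m-i-1}(N))$, $0\le i\le m-1$, such that $$\omega=-d\varphi_{0,m-1},\qquad \delta'\varphi_{i-1,m-i}+\delta''\varphi_{i,m-i-1}=0\quad(1\le i\le m-1),$$ and, for a point $x\in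 N$ (a zero-dimensional cycle), put $c_x(\omega)(g_1,\dots,g_m)=\bigl((\delta'\varphi_{m-1,0})(g_1,\dots,g_m)\bigr)(x)$. We say that the cocycle $c_x(\omega)$ is defined if the above conditions on $N$ and $\omega$ hold, $x$ and $gx$ are joined by a path for each $g\in G$ (so the homology class of $x$ is $G$-invariant), such cochains exist, and, for every choice of them, $c_x(\omega)$ is an $m$-cocycle of the complex $C^*(G,\mathbb R)$ with trivial action on $\mathbb R$ that does not depend on the point $x$ and whose cohomology class does not depend on the choice. It is nontrivial if, for every choice, it is not a coboundary of $C^*(G,\mathbb R)$. **Theorem.** (1) Let $m\ge 1$ and let $M$ be a connected manifold with $H^1(M)=\dots=H^{m-1}(M)=0$. Let $\omega_0$ be a nonzero $m$-form on $\mathbb R^n$ with constant coefficients, $\omega_M$ an exact $m$-form on $M$, and let $\omega=\omega_0+\omega_M$ be the sum of their pull backs to $\mathbb R^n\times M$. Let $G=\operatorname{Diff}(\mathbb R^n\times M,\omega)$ be the group of the diffeomorphisms of $\mathbb R^n\times M$ that preserve $\omega$. Then for each point $x\in\mathbb R^n\times M$ the cocycle $c_x(\omega)$ is defined and nontrivial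 in the complex $C^*(G,\mathbb R)$. (2) Let $\omega_0$ be the standard symplectic 2-form on $\mathbb R^{2n}$ and $1\le m\le n$. Let $M$ be a connected manifold with $H^1(M)=\dots=H^{2m-1}(M)=0$, let $\omega_M$ be an exact $2m$-form on $M$, and let $\omega=\omega_0^m+\omega_M$ on $\mathbb R^{2n}\times M$, $G=\operatorname{Diff}(\mathbb R^{2n}\times M,\omega)$. Then for each point $x\in\mathbb R^{2n}\times M$ the cocycle $c_x(\omega)$ is defined and nontrivial in the complex $C^*(G,\mathbb R)$. -/

import Mathlib

open scoped Manifold ContDiff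

noncomputable section

/-! ### Differential forms on manifolds -/

section Forms

variable {E : Type*} [NormedAddCommGroup E] [NormedSpace ℝ E]
  {H : Type*} [TopologicalSpace H]
  {E' : Type*} [NormedAddCommGroup E'] [NormedSpace ℝ E']
  {H' : Type*} [TopologicalSpace H']

/-- A (not necessarily smooth) real differential `k`-form on `M`: a section of the bundle of
alternating `k`-linear forms on the tangent spaces. -/
abbrev DForm (I : ModelWithCorners ℝ E H) (M : Type*) [TopologicalSpace M] [ChartedSpace H M]
    (k : ℕ) : Type _ :=
  ∀ x : M, TangentSpace I x [⋀^Fin k]→L[ℝ] ℝ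

variable {I : ModelWithCorners ℝ E H} {M : Type*} [TopologicalSpace M] [ChartedSpace H M]
  {I' : ModelWithCorners ℝ E' H'} {M' : Type*} [TopologicalSpace M'] [ChartedSpace H' M']
  {k : ℕ}

namespace DForm

/-- The pull back `f^* w` of a form along a map. -/
def pullback (f : M → M') (w : DForm I' M' k) : DForm I M k :=
  fun x => (w (f x)).compContinuousLinearMap (mfderiv I I' f x)

/-- The expression of `w` in the chart of `M` at `x₀`: the pull back of `w` along the inverse of
that chart, a form on (an open subset of the range of `I` in) the model vector space. -/
def inChart (w : DForm I M k) (x₀ : M) : E → E [⋀^Fin k]→L[ℝ] ℝ :=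
  fun y => (w ((extChartAt I x₀).symm y)).compContinuousLinearMap
    (mfderivWithin 𝓘(ℝ, E) I (extChartAt I x₀).symm (Set.range I) y)

/-- `w` is of class `C^∞`: its coefficients in the charts of `M` are. -/
def IsSmooth (w : DForm I M k) : Prop :=
  ∀ x₀ : M, ContDiffOn ℝ ∞ (w.inChart x₀) (extChartAt I x₀).target

/-- The exterior derivative: at `x` it is computed in the chart at `x`, by the exterior
derivative of the model vector space. -/
def extD (w : DForm I M k) : DForm I M (k + 1) :=
  fun x => (extDerivWithin (w.inChart x) (Set.range I) (extChartAt I x x)).compContinuousLinearMap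
    (mfderiv I 𝓘(ℝ, E) (extChartAt I x) x)

/-- `w` is exact: `w = dη` for a smooth form `η` of degree one less (so `w = 0` in degree `0`). -/
def IsExact : {k : ℕ} → DForm I M k → Prop
  | 0, w => w = 0
  | k + 1, w => ∃ η : DForm I M k, η.IsSmooth ∧ η.extD = w

end DForm

variable (I M) in
/-- `H^q(M, ℝ) = 0`, in terms of de Rham cohomology: every closed smooth `q`-form is exact. -/
def DeRhamVanishes (q : ℕ) : Prop :=
  ∀ w : DForm I M q, w.IsSmooth → w.extD = 0 → w.IsExact

/-- The form with constant coefficients on a normed space defined by an alternating form. -/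
def constForm (w : E [⋀^Fin k]→L[ℝ] ℝ) : DForm 𝓘(ℝ, E) E k :=
  fun _ => w

end Forms

/-! ### Groups of diffeomorphisms -/

section Diff

variable {E : Type*} [NormedAddCommGroup E] [NormedSpace ℝ E]
  {H : Type*} [TopologicalSpace H]
  {I : ModelWithCorners ℝ E H} {M : Type*} [TopologicalSpace M] [ChartedSpace H M] {k : ℕ}

/-- The group of all diffeomorphisms of `M`; the product is composition, `(g * h) x = g (h x)`. -/
instance diffeomorphGroup : Group (M ≃ₘ⟮I, I⟯ M) where
  mul g h := h.trans g
  one := Diffeomorph.refl I M ∞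
  inv g := g.symm
  mul_assoc _ _ _ := rfl
  one_mul _ := rfl
  mul_one _ := rfl
  inv_mul_cancel g := g.self_trans_symm

theorem diffeomorph_mul_apply (g h : M ≃ₘ⟮I, I⟯ M) (x : M) : (g * h) x = g (h x) := rfl

theorem DForm.pullback_one (w : DForm I M k) :
    DForm.pullback (I := I) (⇑(1 : M ≃ₘ⟮I, I⟯ M)) w = w := by
  funext x
  have h : mfderiv I I (⇑(1 : M ≃ₘ⟮I, I⟯ M)) x = ContinuousLinearMap.id ℝ (TangentSpace I x) :=
    mfderiv_id
  unfold DForm.pullback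
  rw [h]
  rfl

theorem DForm.pullback_mul (g h : M ≃ₘ⟮I, I⟯ M) (w : DForm I M k) :
    DForm.pullback (I := I) (⇑(g * h)) w = DForm.pullback (I := I) h (DForm.pullback (I := I) g w) := by
  funext x
  have hc : mfderiv I I (⇑(g * h)) x = (mfderiv I I g (h x)).comp (mfderiv I I h x) :=
    mfderiv_comp x (g.mdifferentiable (by simp) (h x)) (h.mdifferentiable (by simp) x)
  unfold DForm.pullback
  rw [hc]
  rfl

/-- `Diff(M, w)`: the group of the diffeomorphisms of `M` that preserve the form `w`. -/
def diffPreserving (w : DForm I M k) : Subgroup (M ≃ₘ⟮I, I⟯ M) where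
  carrier := {g | DForm.pullback (I := I) g w = w}
  one_mem' := w.pullback_one
  mul_mem' {g h} hg hh := by
    simp only [Set.mem_ofPred_eq] at hg hh ⊢
    rw [DForm.pullback_mul, hg, hh]
  inv_mem' {g} hg := by
    simp only [Set.mem_ofPred_eq] at hg ⊢
    calc DForm.pullback (I := I) (⇑g⁻¹) w
        = DForm.pullback (I := I) (⇑g⁻¹) (DForm.pullback (I := I) g w) := by rw [hg]
      _ = DForm.pullback (I := I) (⇑(g * g⁻¹)) w := (DForm.pullback_mul g g⁻¹ w).symm
      _ = w := by rw [mul_inv_cancel]; exact w.pullback_one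

end Diff

/-! ### Nonhomogeneous cochains of a group -/

section Cochains

/-- The differential `C^p(G, A) → C^{p+1}(G, A)` of nonhomogeneous cochains of `G` with values in
a right `G`-module `A`, whose action is `act a g = a · g`:
`(Df)(g₁, …, g_{p+1}) = f(g₂, …, g_{p+1}) + ∑_{i=1}^p (-1)^i f(g₁, …, g_i g_{i+1}, …, g_{p+1})
  + (-1)^{p+1} f(g₁, …, g_p) · g_{p+1}`. -/
def cochainD {G A : Type*} [Group G] [AddCommGroup A] (act : A → G → A) {p : ℕ}
    (f : (Fin p → G) → A) : (Fin (p + 1) → G) → A :=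
  fun g => f (Fin.tail g)
    + ∑ i : Fin p, (-1 : ℤ) ^ ((i : ℕ) + 1) • f (i.castSucc.contractNth (· * ·) g)
    + (-1 : ℤ) ^ (p + 1) • act (f (Fin.init g)) (g (Fin.last p))

/-- The differential of `C^*(G, ℝ)`, for the trivial `G`-module `ℝ`. -/
def realD {G : Type*} [Group G] {p : ℕ} (f : (Fin p → G) → ℝ) : (Fin (p + 1) → G) → ℝ :=
  cochainD (fun a _ => a) f

/-- `f` is a cocycle of `C^*(G, ℝ)`. -/
def IsRealCocycle {G : Type*} [Group G] {p : ℕ} (f : (Fin p → G) → ℝ) : Prop :=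
  realD f = 0

/-- `f ∈ C^{p+1}(G, ℝ)` is a coboundary, that is, a trivial cocycle. -/
def IsRealCoboundary {G : Type*} [Group G] {p : ℕ} (f : (Fin (p + 1) → G) → ℝ) : Prop :=
  ∃ b : (Fin p → G) → ℝ, realD b = f

variable {E : Type*} [NormedAddCommGroup E] [NormedSpace ℝ E]
  {H : Type*} [TopologicalSpace H]
  {I : ModelWithCorners ℝ E H} {M : Type*} [TopologicalSpace M] [ChartedSpace H M]
  {G : Subgroup (M ≃ₘ⟮I, I⟯ M)}

/-- `δ' : C^p(G, Ω^q(M)) → C^{p+1}(G, Ω^q(M))`, for the right action of `G` by pull backs. -/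
def delta₁ {p q : ℕ} (c : (Fin p → G) → DForm I M q) : (Fin (p + 1) → G) → DForm I M q :=
  cochainD (fun w (g : G) => DForm.pullback (I := I) (⇑(g : M ≃ₘ⟮I, I⟯ M)) w) c

/-- `δ'' : C^p(G, Ω^q(M)) → C^p(G, Ω^{q+1}(M))`, `(δ''c)(g₁, …, g_p) = (-1)^p d(c(g₁, …, g_p))`. -/
def delta₂ {p q : ℕ} (c : (Fin p → G) → DForm I M q) : (Fin p → G) → DForm I M (q + 1) :=
  fun g => (-1 : ℤ) ^ p • (c g).extD

end Cochains

/-! ### The cocycle attached to an invariant exact form and a point -/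

section PointCocycle

variable {E : Type*} [NormedAddCommGroup E] [NormedSpace ℝ E]
  {H : Type*} [TopologicalSpace H]
  {I : ModelWithCorners ℝ E H} {M : Type*} [TopologicalSpace M] [ChartedSpace H M]

/-- A sequence of cochains `φ_{i, m-1-i} ∈ C^i(G, Ω^{m-1-i}(M))`, `0 ≤ i ≤ m - 1`, from which the
cocycle of the `m`-form `w` is made, where `m = k + 1`:
`w = -dφ_{0, m-1}` and `δ'φ_{i-1, m-i} + δ''φ_{i, m-i-1} = 0` for `1 ≤ i ≤ m - 1`.
(Only the members `φ i j` with `i + j = k` of the family `φ` matter.) -/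
structure IsDescent (G : Subgroup (M ≃ₘ⟮I, I⟯ M)) {k : ℕ} (w : DForm I M (k + 1))
    (φ : ∀ i j : ℕ, (Fin i → G) → DForm I M j) : Prop where
  smooth : ∀ i j, i + j = k → ∀ g, (φ i j g).IsSmooth
  base : ∀ g, w = -(φ 0 k g).extD
  step : ∀ i j, i + 1 + j = k → delta₁ (φ i (j + 1)) + delta₂ (φ (i + 1) j) = 0

/-- The cochain `c_x(w)(g₁, …, g_m) = ∫_x (δ'φ_{m-1, 0})(g₁, …, g_m)`, `m = k + 1`: the value at
the point `x` of the function `(δ'φ_{m-1, 0})(g₁, …, g_m)`. -/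
def pointCocycle (G : Subgroup (M ≃ₘ⟮I, I⟯ M)) (k : ℕ)
    (φ : ∀ i j : ℕ, (Fin i → G) → DForm I M j) (x : M) : (Fin (k + 1) → G) → ℝ :=
  fun g => delta₁ (φ k 0) g x ![]

/-- The data needed for the cocycle of the `m`-form `w`, `m = k + 1`, on the group `G`, with the
point `x` as zero-dimensional cycle: `w` is smooth, exact and `G`-invariant,
`H^1(M) = … = H^{m-1}(M) = 0`, `H^0(M) ≠ 0`, and the homology class of `x` is `G`-invariant:
`x` and `g x` are joined by a path. -/
structure PointCocycleConditions (G : Subgroup (M ≃ₘ⟮I, I⟯ M)) {k : ℕ} (w : DForm I M (k + 1))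
    (x : M) : Prop where
  smooth : w.IsSmooth
  exact : w.IsExact
  invariant : ∀ g ∈ G, DForm.pullback (I := I) (⇑g) w = w
  vanishing : ∀ q, 1 ≤ q → q ≤ k → DeRhamVanishes I M q
  nonvanishing : ¬ DeRhamVanishes I M 0
  class_invariant : ∀ g ∈ G, Joined x (g x)

/-- The cocycle `c_x(w)` of `C^*(G, ℝ)` is defined: the conditions above hold, sequences `φ` as
above exist, each of them yields a cocycle, this cocycle is the same for all points, and different
sequences yield cohomologous cocycles. -/
structure PointCocycleDefined (G : Subgroup (M ≃ₘ⟮I, I⟯ M)) {k : ℕ} (w : DForm I M (k + 1))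
    (x : M) : Prop where
  conditions : PointCocycleConditions G w x
  exists_descent : ∃ φ, IsDescent G w φ
  isCocycle : ∀ φ, IsDescent G w φ → IsRealCocycle (pointCocycle G k φ x)
  point_independent : ∀ φ, IsDescent G w φ → ∀ y : M, pointCocycle G k φ y = pointCocycle G k φ x
  choice_independent : ∀ φ ψ, IsDescent G w φ → IsDescent G w ψ →
    IsRealCoboundary (pointCocycle G k φ x - pointCocycle G k ψ x)

/-- The cocycle `c_x(w)`, for any choice of the sequence `φ`, is nontrivial in `C^*(G, ℝ)`. -/
def PointCocycleNontrivial (G : Subgroup (M ≃ₘ⟮I, I⟯ M)) {k : ℕ} (w : DForm I M (k + 1))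
    (x : M) : Prop :=
  ∀ φ, IsDescent G w φ → ¬ IsRealCoboundary (pointCocycle G k φ x)

end PointCocycle

/-! ### The form `ω₀ + ω_M` on a product -/

section Sum

variable {V : Type*} [NormedAddCommGroup V] [NormedSpace ℝ V]
  {E : Type*} [NormedAddCommGroup E] [NormedSpace ℝ E]
  {H : Type*} [TopologicalSpace H]
  {I : ModelWithCorners ℝ E H} {M : Type*} [TopologicalSpace M] [ChartedSpace H M] {k : ℕ}

/-- The form `ω₀ + ω_M` on `V × M`: the sum of the pull backs, along the two projections, of the
form with constant coefficients `ω₀` on `V` and of the form `ω_M` on `M`. -/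
def sumForm (ω₀ : V [⋀^Fin k]→L[ℝ] ℝ) (ωM : DForm I M k) : DForm (𝓘(ℝ, V).prod I) (V × M) k :=
  DForm.pullback (I' := 𝓘(ℝ, V)) Prod.fst (constForm ω₀)
    + DForm.pullback (I' := I) Prod.snd ωM

end Sum

/-! ### Powers of the standard symplectic form -/

section Symplectic

variable {V : Type*} [AddCommGroup V] [Module ℝ V]

/-- The wedge product of alternating forms: the signed sum over shuffles. -/
def altWedge {k l : ℕ} (a : V [⋀^Fin k]→ₗ[ℝ] ℝ) (b : V [⋀^Fin l]→ₗ[ℝ] ℝ) :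
    V [⋀^Fin (k + l)]→ₗ[ℝ] ℝ :=
  ((LinearMap.mul' ℝ ℝ).compAlternatingMap (a.domCoprod b)).domDomCongr finSumFinEquiv

/-- The power `a^m = a ∧ … ∧ a` of an alternating 2-form. -/
def altWedgePow (a : V [⋀^Fin 2]→ₗ[ℝ] ℝ) : (m : ℕ) → V [⋀^Fin (2 * m)]→ₗ[ℝ] ℝ
  | 0 => AlternatingMap.constOfIsEmpty ℝ V (Fin 0) 1
  | m + 1 => altWedge (altWedgePow a m) a

/-- The coordinate 1-form `dx_i` on `ℝ^N`. -/
def coordForm {N : ℕ} (i : Fin N) : EuclideanSpace ℝ (Fin N) [⋀^Fin 1]→ₗ[ℝ] ℝ :=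
  AlternatingMap.ofSubsingleton ℝ (EuclideanSpace ℝ (Fin N)) ℝ (0 : Fin 1)
    (EuclideanSpace.proj i : EuclideanSpace ℝ (Fin N) →L[ℝ] ℝ).toLinearMap

/-- The standard symplectic form `∑_{i=1}^n dx_i ∧ dx_{n+i}` on `ℝ^{2n}`. -/
def stdSymplectic (n : ℕ) : EuclideanSpace ℝ (Fin (2 * n)) [⋀^Fin 2]→ₗ[ℝ] ℝ :=
  ∑ i : Fin n, altWedge (coordForm ⟨i, by omega⟩) (coordForm ⟨n + i, by omega⟩)

theorem multilinear_continuous_of_finiteDimensional {W : Type*} [NormedAddCommGroup W]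
    [NormedSpace ℝ W] [FiniteDimensional ℝ W] {k : ℕ}
    (f : MultilinearMap ℝ (fun _ : Fin k => W) ℝ) : Continuous f := by
  let b := Module.finBasis ℝ W
  have h : (f : (Fin k → W) → ℝ) = fun v => ∑ r : Fin k → Fin (Module.finrank ℝ W),
      (∏ i, b.coord (r i) (v i)) • f (fun i => b (r i)) := by
    funext v
    conv_lhs => rw [show v = fun i => ∑ j, b.coord j (v i) • b j from
      funext fun i => (b.sum_repr (v i)).symm]
    rw [MultilinearMap.map_sum]
    exact Finset.sum_congr rfl fun r _ => f.map_smul_univ _ _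
  rw [h]
  refine continuous_finsetSum _ fun r _ => ?_
  refine (continuous_finsetProd Finset.univ fun i _ => ?_).mul continuous_const
  exact (LinearMap.continuous_of_finiteDimensional (b.coord (r i))).comp (continuous_apply i)

/-- An alternating form on a finite-dimensional space, as a continuous alternating form. -/
def altToContinuous {W : Type*} [NormedAddCommGroup W] [NormedSpace ℝ W] [FiniteDimensional ℝ W]
    {k : ℕ} (a : W [⋀^Fin k]→ₗ[ℝ] ℝ) : W [⋀^Fin k]→L[ℝ] ℝ where
  toMultilinearMap := a.toMultilinearMap
  cont := multilinear_continuous_of_finiteDimensional a.toMultilinearMap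
  map_eq_zero_of_eq' := a.map_eq_zero_of_eq'

/-- The power `w₀^m` of the standard symplectic form `w₀` on `ℝ^{2n}`, for `m = j + 1`. -/
def stdSymplecticPow (n j : ℕ) :
    EuclideanSpace ℝ (Fin (2 * n)) [⋀^Fin (2 * j + 1 + 1)]→L[ℝ] ℝ :=
  altToContinuous (altWedgePow (stdSymplectic n) (j + 1))

end Symplectic

end

noncomputable section

set_option linter.unusedSectionVars false

/-! ### Smooth families of alternating forms -/

section Alternating

variable {E : Type*} [NormedAddCommGroup E] [NormedSpace ℝ E] [FiniteDimensional ℝ E]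
  {E' : Type*} [NormedAddCommGroup E'] [NormedSpace ℝ E']
  {X : Type*} [NormedAddCommGroup X] [NormedSpace ℝ X] {k : ℕ} {n : WithTop ℕ∞}

/-- A family of alternating forms on a finite-dimensional space is `C^n` as soon as its values on
all tuples of vectors are. -/
theorem contDiffAt_alternating_of_apply {f : X → E [⋀^Fin k]→L[ℝ] ℝ} {x : X}
    (h : ∀ v, ContDiffAt ℝ n (fun y => f y v) x) : ContDiffAt ℝ n f x := by
  let b := Module.finBasis ℝ E
  let ev : (E [⋀^Fin k]→L[ℝ] ℝ) →ₗ[ℝ] ((Fin k → Fin (Module.finrank ℝ E)) → ℝ) :=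
    { toFun := fun a r => a fun i => b (r i)
      map_add' := fun _ _ => rfl
      map_smul' := fun _ _ => rfl }
  have hinj : LinearMap.ker ev = ⊥ := by
    rw [LinearMap.ker_eq_bot']
    intro a ha
    have h0 : a.toMultilinearMap = 0 :=
      Module.Basis.ext_multilinear (fun _ => b) fun r => congrFun ha r
    ext v
    exact congrArg (fun m : MultilinearMap ℝ (fun _ : Fin k => E) ℝ => m v) h0
  obtain ⟨g, hg⟩ := ev.exists_leftInverse_of_injective hinj
  have hf : f = fun y => LinearMap.toContinuousLinearMap g (fun r => f y fun i => b (r i)) := by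
    funext y
    exact (LinearMap.congr_fun hg (f y)).symm
  rw [hf]
  exact (LinearMap.toContinuousLinearMap g).contDiff.contDiffAt.comp x
    (contDiffAt_pi.2 fun r => h _)

omit [FiniteDimensional ℝ E] in
theorem ContDiffAt.alternating_apply {f : X → E [⋀^Fin k]→L[ℝ] ℝ} {x : X}
    (h : ContDiffAt ℝ n f x) (v : Fin k → E) : ContDiffAt ℝ n (fun y => f y v) x :=
  (ContinuousAlternatingMap.apply ℝ E ℝ v).contDiff.contDiffAt.comp x h

theorem ContDiffAt.alternating_compContinuousLinearMap {f : X → E' [⋀^Fin k]→L[ℝ] ℝ}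
    {g : X → E →L[ℝ] E'} {x : X} (hf : ContDiffAt ℝ n f x) (hg : ContDiffAt ℝ n g x) :
    ContDiffAt ℝ n (fun y => (f y).compContinuousLinearMap (g y)) x := by
  refine contDiffAt_alternating_of_apply fun v => ?_
  have h1 : ContDiffAt ℝ n (fun y => (f y).toContinuousMultilinearMap) x :=
    (ContinuousAlternatingMap.toContinuousMultilinearMapLI (𝕜 := ℝ) (E := E') (ι := Fin k)
      (F := ℝ)).contDiff.contDiffAt.comp x hf
  have h2 : ContDiffAt ℝ n (fun y =>
      ContinuousMultilinearMap.compContinuousLinearMapContinuousMultilinear ℝ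
        (fun _ : Fin k => E) (fun _ : Fin k => E') ℝ (fun _ => g y)) x :=
    (ContinuousMultilinearMap.contDiff _).contDiffAt.comp x (contDiffAt_pi.2 fun _ => hg)
  exact (ContinuousMultilinearMap.apply ℝ (fun _ : Fin k => E) ℝ v).contDiff.contDiffAt.comp x
    (h2.clm_apply h1)

end Alternating

/-! ### The calculus of forms on manifolds without boundary -/

section Calculus

variable {E : Type*} [NormedAddCommGroup E] [NormedSpace ℝ E]
  {H : Type*} [TopologicalSpace H] {I : ModelWithCorners ℝ E H} [I.Boundaryless]
  {M : Type*} [TopologicalSpace M] [ChartedSpace H M]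
  {E' : Type*} [NormedAddCommGroup E'] [NormedSpace ℝ E']
  {H' : Type*} [TopologicalSpace H'] {I' : ModelWithCorners ℝ E' H'} [I'.Boundaryless]
  {M' : Type*} [TopologicalSpace M'] [ChartedSpace H' M']
  {k : ℕ}

namespace DForm

theorem inChart_eq (w : DForm I M k) (x₀ : M) (y : E) :
    w.inChart x₀ y = (w ((extChartAt I x₀).symm y)).compContinuousLinearMap
      (mfderiv 𝓘(ℝ, E) I (extChartAt I x₀).symm y) := by
  unfold inChart
  rw [I.range_eq_univ, mfderivWithin_univ]
  rfl

theorem extD_eq (w : DForm I M k) (x : M) :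
    w.extD x = (extDeriv (w.inChart x) (extChartAt I x x)).compContinuousLinearMap
      (mfderiv I 𝓘(ℝ, E) (extChartAt I x) x) := by
  unfold extD
  rw [I.range_eq_univ, extDerivWithin_univ]

omit [I.Boundaryless] in
theorem compContinuousLinearMap_congr (w : DForm I M k) {p q : M} (h : p = q)
    {A : E' →L[ℝ] TangentSpace I p} {B : E' →L[ℝ] TangentSpace I q}
    (hAB : (show E' →L[ℝ] E from A) = B) :
    (w p).compContinuousLinearMap A = (w q).compContinuousLinearMap B := by
  subst h
  exact congrArg (w p).compContinuousLinearMap hAB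

section

variable [IsManifold I ∞ M]

theorem _root_.mdifferentiableAt_extChartAt_symm {x₀ : M} {y : E}
    (hy : y ∈ (extChartAt I x₀).target) :
    MDifferentiableAt 𝓘(ℝ, E) I (extChartAt I x₀).symm y := by
  have : IsManifold I 1 M := .of_le (n := ∞) (by simp)
  have h := mdifferentiableWithinAt_extChartAt_symm hy
  rwa [I.range_eq_univ, mdifferentiableWithinAt_univ] at h

theorem _root_.mdifferentiableAt_extChartAt_of_mem {x₀ x : M}
    (hx : x ∈ (extChartAt I x₀).source) :
    MDifferentiableAt I 𝓘(ℝ, E) (extChartAt I x₀) x := by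
  have : IsManifold I 1 M := .of_le (n := ∞) (by simp)
  exact mdifferentiableAt_extChartAt (by rwa [extChartAt_source] at hx)

theorem _root_.contMDiffAt_extChartAt_symm {x₀ : M} {y : E}
    (hy : y ∈ (extChartAt I x₀).target) :
    ContMDiffAt 𝓘(ℝ, E) I ∞ (extChartAt I x₀).symm y :=
  (contMDiffOn_extChartAt_symm x₀).contMDiffAt ((isOpen_extChartAt_target x₀).mem_nhds hy)

theorem isSmooth_iff (w : DForm I M k) : w.IsSmooth ↔
    ∀ x₀ : M, ∀ y ∈ (extChartAt I x₀).target, ContDiffAt ℝ ∞ (w.inChart x₀) y :=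
  forall_congr' fun x₀ => ⟨fun h _ hy => h.contDiffAt ((isOpen_extChartAt_target x₀).mem_nhds hy),
    fun h _ hy => (h _ hy).contDiffWithinAt⟩

theorem IsSmooth.contDiffAt {w : DForm I M k} (hw : w.IsSmooth) (x : M) :
    ContDiffAt ℝ ∞ (w.inChart x) (extChartAt I x x) :=
  w.isSmooth_iff.1 hw x _ (mem_extChartAt_target x)

variable [IsManifold I' ∞ M']

omit [I.Boundaryless] [I'.Boundaryless] [IsManifold I ∞ M] [IsManifold I' ∞ M'] in
theorem eventually_mem_source [I.Boundaryless] [IsManifold I ∞ M] {f : M → M'} (hf : Continuous f) {x₀ : M} {y : E}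
    (hy : y ∈ (extChartAt I x₀).target) {x₁ : M'}
    (hx : f ((extChartAt I x₀).symm y) ∈ (extChartAt I' x₁).source) :
    ∀ᶠ z in nhds y, z ∈ (extChartAt I x₀).target ∧
      f ((extChartAt I x₀).symm z) ∈ (extChartAt I' x₁).source := by
  have hc : ContinuousAt (fun z => f ((extChartAt I x₀).symm z)) y :=
    hf.continuousAt.comp (mdifferentiableAt_extChartAt_symm hy).continuousAt
  exact ((isOpen_extChartAt_target x₀).mem_nhds hy |> Filter.eventually_mem_set.2).and
    (hc.eventually ((isOpen_extChartAt_source x₁).mem_nhds hx |> Filter.eventually_mem_set.2))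

theorem contDiffAt_writtenInExtChart {f : M → M'} (hf : ContMDiff I I' ∞ f) {x₀ : M} {y : E}
    (hy : y ∈ (extChartAt I x₀).target) {x₁ : M'}
    (hx : f ((extChartAt I x₀).symm y) ∈ (extChartAt I' x₁).source) :
    ContDiffAt ℝ ∞ (extChartAt I' x₁ ∘ f ∘ (extChartAt I x₀).symm) y := by
  rw [← contMDiffAt_iff_contDiffAt]
  exact (contMDiffAt_extChartAt' (by rwa [extChartAt_source] at hx)).comp y
    (hf.contMDiffAt.comp y (contMDiffAt_extChartAt_symm hy))

theorem inChart_pullback {f : M → M'} (hf : ContMDiff I I' ∞ f) (w : DForm I' M' k)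
    {x₀ : M} {y : E} (hy : y ∈ (extChartAt I x₀).target) {x₁ : M'}
    (hx : f ((extChartAt I x₀).symm y) ∈ (extChartAt I' x₁).source) :
    (pullback (I := I) f w).inChart x₀ y =
      (w.inChart x₁ ((extChartAt I' x₁ ∘ f ∘ (extChartAt I x₀).symm) y)).compContinuousLinearMap
        (fderiv ℝ (extChartAt I' x₁ ∘ f ∘ (extChartAt I x₀).symm) y) := by
  set F := extChartAt I' x₁ ∘ f ∘ (extChartAt I x₀).symm with hF
  have hFd : MDifferentiableAt 𝓘(ℝ, E) 𝓘(ℝ, E') F y :=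
    ((contDiffAt_writtenInExtChart hf hy hx).differentiableAt (by simp)).mdifferentiableAt
  have hFt : F y ∈ (extChartAt I' x₁).target := (extChartAt I' x₁).map_source hx
  have hinv : (extChartAt I' x₁).symm (F y) = f ((extChartAt I x₀).symm y) :=
    (extChartAt I' x₁).left_inv hx
  rw [inChart_eq, inChart_eq]
  refine (compContinuousLinearMap_congr (E' := E) w hinv.symm 
    (A := (mfderiv I I' f ((extChartAt I x₀).symm y)).comp
      (mfderiv 𝓘(ℝ, E) I (extChartAt I x₀).symm y))
    (B := (mfderiv 𝓘(ℝ, E') I' (extChartAt I' x₁).symm (F y)).comp (fderiv ℝ F y)) ?_)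
  have h1 := mfderiv_comp y (hf.mdifferentiable (by simp) _) (mdifferentiableAt_extChartAt_symm hy)
  have h2 := mfderiv_comp y (mdifferentiableAt_extChartAt_symm hFt) hFd
  rw [mfderiv_eq_fderiv] at h2
  refine h1.symm.trans (Eq.trans ?_ h2)
  refine Filter.EventuallyEq.mfderiv_eq ?_
  filter_upwards [eventually_mem_source hf.continuous hy hx] with z hz
  exact ((extChartAt I' x₁).left_inv hz.2).symm

theorem IsSmooth.pullback [FiniteDimensional ℝ E] {w : DForm I' M' k} (hw : w.IsSmooth)
    {f : M → M'} (hf : ContMDiff I I' ∞ f) : (pullback (I := I) f w).IsSmooth := by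
  rw [isSmooth_iff]
  intro x₀ y hy
  set x₁ := f ((extChartAt I x₀).symm y)
  have hx : f ((extChartAt I x₀).symm y) ∈ (extChartAt I' x₁).source := mem_extChartAt_source x₁
  have hF := contDiffAt_writtenInExtChart hf hy hx
  have h := (((w.isSmooth_iff.1 hw x₁ _ ((extChartAt I' x₁).map_source hx)).comp y
    hF).alternating_compContinuousLinearMap (hF.fderiv_right (m := ∞) (by simp)))
  refine h.congr_of_eventuallyEq ?_
  filter_upwards [eventually_mem_source hf.continuous hy hx] with z hz
  exact inChart_pullback hf w hz.1 hz.2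

/-- The exterior derivative commutes with pull backs. -/
theorem extD_pullback {w : DForm I' M' k} (hw : w.IsSmooth)
    {f : M → M'} (hf : ContMDiff I I' ∞ f) :
    (pullback (I := I) f w).extD = pullback (I := I) f w.extD := by
  funext x
  have hy := mem_extChartAt_target (I := I) x
  have hxx : (extChartAt I x).symm (extChartAt I x x) = x := extChartAt_to_inv x
  have hx : f ((extChartAt I x).symm (extChartAt I x x)) ∈ (extChartAt I' (f x)).source := by
    rw [hxx]; exact mem_extChartAt_source _
  set F := extChartAt I' (f x) ∘ f ∘ (extChartAt I x).symm with hF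
  have hFx : F (extChartAt I x x) = extChartAt I' (f x) (f x) := by
    simp only [hF, Function.comp_apply, hxx]
  have hFd := contDiffAt_writtenInExtChart hf hy hx
  have he : (DForm.pullback (I := I) f w).inChart x =ᶠ[nhds (extChartAt I x x)]
      fun z => (w.inChart (f x) (F z)).compContinuousLinearMap (fderiv ℝ F z) := by
    filter_upwards [eventually_mem_source hf.continuous hy hx] with z hz
    exact inChart_pullback hf w hz.1 hz.2
  have hwd : DifferentiableAt ℝ (w.inChart (f x)) (F (extChartAt I x x)) := by
    rw [hFx]; exact (hw.contDiffAt (f x)).differentiableAt (by simp)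
  rw [extD_eq, he.extDeriv_eq, extDeriv_pullback hwd hFd (r := ∞) (by simp; exact WithTop.coe_le_coe.2 le_top), hFx]
  change _ = (w.extD (f x)).compContinuousLinearMap _
  rw [extD_eq]
  have h1 := mfderiv_comp x ((hFd.differentiableAt (by simp)).mdifferentiableAt)
    (mdifferentiableAt_extChartAt_of_mem (mem_extChartAt_source (I := I) x))
  have h2 := mfderiv_comp x
    (mdifferentiableAt_extChartAt_of_mem (mem_extChartAt_source (I := I') (f x)))
    (hf.mdifferentiable (by simp) x)
  rw [mfderiv_eq_fderiv] at h1
  have h3 : mfderiv I 𝓘(ℝ, E') (F ∘ extChartAt I x) x =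
      mfderiv I 𝓘(ℝ, E') (extChartAt I' (f x) ∘ f) x := by
    refine Filter.EventuallyEq.mfderiv_eq ?_
    filter_upwards [extChartAt_source_mem_nhds (I := I) x] with z hz
    simp only [hF, Function.comp_apply, (extChartAt I x).left_inv hz]
  ext v
  exact congrArg (fun A : E →L[ℝ] E' => extDeriv (w.inChart (f x))
    (extChartAt I' (f x) (f x)) fun i => A (v i)) (h1.symm.trans (h3.trans h2))

end

section Linear

variable (w w' : DForm I M k) (c : ℝ) (x₀ : M)

omit [I.Boundaryless] in
theorem inChart_add : (w + w').inChart x₀ = w.inChart x₀ + w'.inChart x₀ := rfl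

omit [I.Boundaryless] in
theorem inChart_smul : (c • w).inChart x₀ = c • w.inChart x₀ := rfl

omit [I.Boundaryless] in
theorem inChart_zero : (0 : DForm I M k).inChart x₀ = 0 := rfl

variable {w w'}

omit [I.Boundaryless] in
theorem isSmooth_zero : (0 : DForm I M k).IsSmooth := fun x₀ => by
  rw [inChart_zero]; exact contDiffOn_const

omit [I.Boundaryless] in
theorem IsSmooth.add (hw : w.IsSmooth) (hw' : w'.IsSmooth) : (w + w').IsSmooth :=
  fun x₀ => (hw x₀).add (hw' x₀)

omit [I.Boundaryless] in
theorem IsSmooth.smul (hw : w.IsSmooth) : (c • w).IsSmooth :=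
  fun x₀ => (hw x₀).const_smul c

omit [I.Boundaryless] in
theorem IsSmooth.neg (hw : w.IsSmooth) : (-w).IsSmooth := by
  rw [← neg_one_smul ℝ w]; exact hw.smul (-1)

omit [I.Boundaryless] in
theorem IsSmooth.sub (hw : w.IsSmooth) (hw' : w'.IsSmooth) : (w - w').IsSmooth := by
  simpa [sub_eq_add_neg] using hw.add hw'.neg

omit [I.Boundaryless] in
theorem IsSmooth.zsmul (hw : w.IsSmooth) (n : ℤ) : (n • w).IsSmooth := by
  rw [← Int.cast_smul_eq_zsmul ℝ n w]; exact hw.smul n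

omit [I.Boundaryless] in
theorem IsSmooth.sum {ι : Type*} (s : Finset ι) {f : ι → DForm I M k}
    (h : ∀ i ∈ s, (f i).IsSmooth) : (∑ i ∈ s, f i).IsSmooth := by
  classical
  induction s using Finset.induction_on with
  | empty => exact isSmooth_zero
  | insert a s ha ih =>
    rw [Finset.sum_insert ha]
    exact (h a (Finset.mem_insert_self a s)).add
      (ih fun i hi => h i (Finset.mem_insert_of_mem hi))

theorem extD_smul : (c • w).extD = c • w.extD := by
  funext x
  change _ = c • w.extD x
  rw [extD_eq, extD_eq, inChart_smul, extDeriv_smul]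
  rfl

theorem extD_zero : (0 : DForm I M k).extD = 0 := by
  simpa using extD_smul (w := (0 : DForm I M k)) 0

theorem extD_neg : (-w).extD = -w.extD := by
  rw [← neg_one_smul ℝ w, extD_smul]; exact neg_one_smul ℝ w.extD

theorem extD_zsmul (n : ℤ) : (n • w).extD = n • w.extD := by
  rw [← Int.cast_smul_eq_zsmul ℝ n w, extD_smul]; exact Int.cast_smul_eq_zsmul ℝ n w.extD

variable [IsManifold I ∞ M]

theorem extD_add (hw : w.IsSmooth) (hw' : w'.IsSmooth) : (w + w').extD = w.extD + w'.extD := by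
  funext x
  change _ = w.extD x + w'.extD x
  rw [extD_eq, extD_eq, extD_eq, inChart_add,
    extDeriv_add ((hw.contDiffAt x).differentiableAt (by simp))
      ((hw'.contDiffAt x).differentiableAt (by simp))]
  rfl

theorem extD_sub (hw : w.IsSmooth) (hw' : w'.IsSmooth) : (w - w').extD = w.extD - w'.extD := by
  rw [sub_eq_add_neg, extD_add hw hw'.neg, extD_neg, sub_eq_add_neg]

theorem extD_sum {ι : Type*} (s : Finset ι) {f : ι → DForm I M k}
    (h : ∀ i ∈ s, (f i).IsSmooth) : (∑ i ∈ s, f i).extD = ∑ i ∈ s, (f i).extD := by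
  classical
  induction s using Finset.induction_on with
  | empty => exact extD_zero
  | insert a s ha ih =>
    rw [Finset.sum_insert ha, Finset.sum_insert ha,
      extD_add (h a (Finset.mem_insert_self a s))
        (IsSmooth.sum s fun i hi => h i (Finset.mem_insert_of_mem hi)),
      ih fun i hi => h i (Finset.mem_insert_of_mem hi)]

end Linear

section Pullback

omit [I.Boundaryless] [I'.Boundaryless]

theorem pullback_add (f : M → M') (w w' : DForm I' M' k) :
    pullback (I := I) f (w + w') = pullback f w + pullback f w' := rfl

theorem pullback_id (w : DForm I M k) : pullback (I := I) id w = w := by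
  funext x
  unfold pullback
  rw [mfderiv_id]
  rfl

theorem pullback_comp {E'' : Type*} [NormedAddCommGroup E''] [NormedSpace ℝ E'']
    {H'' : Type*} [TopologicalSpace H''] {I'' : ModelWithCorners ℝ E'' H''}
    {M'' : Type*} [TopologicalSpace M''] [ChartedSpace H'' M'']
    {g : M' → M''} {f : M → M'} (hg : MDifferentiable I' I'' g) (hf : MDifferentiable I I' f)
    (w : DForm I'' M'' k) :
    pullback (I := I) (g ∘ f) w = pullback f (pullback (I := I') g w) := by
  funext x
  unfold pullback
  rw [mfderiv_comp x (hg _) (hf x)]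
  rfl

end Pullback

end DForm

end Calculus

/-! ### Integrals depending smoothly on a parameter -/

section ParametricIntegral

universe u

variable {E : Type u} [NormedAddCommGroup E] [NormedSpace ℝ E] [FiniteDimensional ℝ E]

theorem continuous_slice {G : Type*} [TopologicalSpace G] {U : Set E} {f : ℝ × E → G}
    (hf : ∀ t, ∀ y ∈ U, ContinuousAt f (t, y)) {y : E} (hy : y ∈ U) :
    Continuous fun t : ℝ => f (t, y) :=
  continuous_iff_continuousAt.2 fun t =>
    ContinuousAt.comp (f := fun s : ℝ => (s, y)) (hf t y hy)
      (continuousAt_id.prodMk continuousAt_const)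

theorem hasFDerivAt_parametric_integral {G : Type*} [NormedAddCommGroup G] [NormedSpace ℝ G]
    [CompleteSpace G] {U : Set E} (hU : IsOpen U) {f : ℝ × E → G}
    (hf : ∀ t, ∀ y ∈ U, ContDiffAt ℝ ∞ f (t, y)) {y : E} (hy : y ∈ U) :
    HasFDerivAt (fun z => ∫ t in (0 : ℝ)..1, f (t, z))
      (∫ t in (0 : ℝ)..1, (fderiv ℝ f (t, y)).comp (ContinuousLinearMap.inr ℝ ℝ E)) y := by
  have hf' : ∀ t, ∀ y ∈ U, ContinuousAt
      (fun p => (fderiv ℝ f p).comp (ContinuousLinearMap.inr ℝ ℝ E)) (t, y) := fun t y hy =>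
    (((hf t y hy).fderiv_right (m := ∞) (by simp)).clm_comp contDiffAt_const).continuousAt
  obtain ⟨ε, hε, hεU⟩ := Metric.nhds_basis_closedBall.mem_iff.1 (hU.mem_nhds hy)
  have hK : IsCompact (Set.Icc (0 : ℝ) 1 ×ˢ Metric.closedBall y ε) :=
    isCompact_Icc.prod (isCompact_closedBall y ε)
  obtain ⟨C, hC⟩ := hK.exists_bound_of_continuousOn
    (f := fun p => (fderiv ℝ f p).comp (ContinuousLinearMap.inr ℝ ℝ E))
    fun p hp => (hf' p.1 p.2 (hεU hp.2)).continuousWithinAt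
  refine intervalIntegral.hasFDerivAt_integral_of_dominated_of_fderiv_le
    (F := fun z t => f (t, z))
    (F' := fun z t => (fderiv ℝ f (t, z)).comp (ContinuousLinearMap.inr ℝ ℝ E))
    (bound := fun _ => C) (Metric.closedBall_mem_nhds y hε) ?_ ?_ ?_ ?_ ?_ ?_
  · filter_upwards [hU.mem_nhds hy] with z hz
    exact (continuous_slice (fun t y hy => (hf t y hy).continuousAt) hz).aestronglyMeasurable
  · exact (continuous_slice (fun t y hy => (hf t y hy).continuousAt) hy).intervalIntegrable _ _
  · exact (continuous_slice hf' hy).aestronglyMeasurable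
  · refine Filter.Eventually.of_forall fun t ht z hz => hC (t, z) ⟨?_, hz⟩
    rw [Set.uIoc_of_le zero_le_one] at ht
    exact Set.Ioc_subset_Icc_self ht
  · exact intervalIntegrable_const
  · refine Filter.Eventually.of_forall fun t _ z hz => ?_
    exact HasFDerivAt.comp (f := fun z : E => (t, z)) z
      ((hf t z (hεU hz)).differentiableAt (by simp)).hasFDerivAt (hasFDerivAt_prodMk_right t z)

theorem contDiffOn_parametric_integral {G : Type u} [NormedAddCommGroup G] [NormedSpace ℝ G]
    [CompleteSpace G] {U : Set E} (hU : IsOpen U) {f : ℝ × E → G}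
    (hf : ∀ t, ∀ y ∈ U, ContDiffAt ℝ ∞ f (t, y)) :
    ContDiffOn ℝ ∞ (fun z => ∫ t in (0 : ℝ)..1, f (t, z)) U := by
  rw [contDiffOn_infty]
  intro n
  induction n generalizing G with
  | zero =>
    exact contDiffOn_zero.2 fun y hy =>
      (hasFDerivAt_parametric_integral hU hf hy).continuousAt.continuousWithinAt
  | succ n ih =>
    push_cast
    rw [contDiffOn_succ_iff_fderiv_of_isOpen hU]
    refine ⟨fun y hy =>
      (hasFDerivAt_parametric_integral hU hf hy).differentiableAt.differentiableWithinAt,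
      by simp, ?_⟩
    refine (ih (f := fun p => (fderiv ℝ f p).comp (ContinuousLinearMap.inr ℝ ℝ E))
      fun t y hy => ((hf t y hy).fderiv_right (m := ∞) (by simp)).clm_comp
        contDiffAt_const).congr fun y hy => ?_
    exact (hasFDerivAt_parametric_integral hU hf hy).fderiv

end ParametricIntegral

/-! ### Integration of forms along the interval -/

section FiberIntegral

universe u

variable {E : Type u} [NormedAddCommGroup E] [NormedSpace ℝ E] [FiniteDimensional ℝ E] {k : ℕ}

/-- The contraction of a form on `ℝ × E` with the unit vector of `ℝ`, restricted to `E`. -/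
def contractTime (a : (ℝ × E) [⋀^Fin (k + 1)]→L[ℝ] ℝ) : E [⋀^Fin k]→L[ℝ] ℝ :=
  (a.curryLeft (1, 0)).compContinuousLinearMap (ContinuousLinearMap.inr ℝ ℝ E)

omit [FiniteDimensional ℝ E] in
theorem contractTime_apply (a : (ℝ × E) [⋀^Fin (k + 1)]→L[ℝ] ℝ) (v : Fin k → E) :
    contractTime a v = a (Fin.cons (1, 0) fun i => (0, v i)) := rfl

theorem ContDiffAt.contractTime {X : Type*} [NormedAddCommGroup X] [NormedSpace ℝ X]
    {f : X → (ℝ × E) [⋀^Fin (k + 1)]→L[ℝ] ℝ} {n : WithTop ℕ∞} {x : X} (hf : ContDiffAt ℝ n f x) :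
    ContDiffAt ℝ n (fun y => contractTime (f y)) x :=
  contDiffAt_alternating_of_apply fun _ => hf.alternating_apply _

theorem extDeriv_integral_contractTime {U : Set E} (hU : IsOpen U)
    {f : ℝ × E → (ℝ × E) [⋀^Fin (k + 1)]→L[ℝ] ℝ}
    (hf : ∀ t, ∀ y ∈ U, ContDiffAt ℝ ∞ f (t, y)) {y : E} (hy : y ∈ U)
    (hd : ∀ t, extDeriv f (t, y) = 0) :
    extDeriv (fun z => ∫ t in (0 : ℝ)..1, contractTime (f (t, z))) y =
      (f (1, y)).compContinuousLinearMap (ContinuousLinearMap.inr ℝ ℝ E)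
        - (f (0, y)).compContinuousLinearMap (ContinuousLinearMap.inr ℝ ℝ E) := by
  have hc : ∀ t, ∀ y ∈ U, ContDiffAt ℝ ∞ (fun p => contractTime (f p)) (t, y) :=
    fun t y hy => (hf t y hy).contractTime
  ext v
  have hval : ∀ u : Fin k → E, ∀ z ∈ U,
      (∫ t in (0 : ℝ)..1, contractTime (f (t, z))) u =
        ∫ t in (0 : ℝ)..1, f (t, z) (Fin.cons (1, 0) fun i => (0, u i)) := by
    intro u z hz
    exact ((ContinuousAlternatingMap.apply ℝ E ℝ u).intervalIntegral_comp_comm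
      ((continuous_slice (fun t y hy => (hc t y hy).continuousAt) hz).intervalIntegrable
        0 1)).symm
  have hs : ∀ u : Fin (k + 1) → ℝ × E, ∀ t, ∀ y ∈ U, ContDiffAt ℝ ∞ (fun p => f p u) (t, y) :=
    fun u t y hy => (hf t y hy).alternating_apply u
  have hcont : ∀ (u : Fin (k + 1) → ℝ × E) (e : ℝ × E),
      Continuous fun t : ℝ => fderiv ℝ (fun p => f p u) (t, y) e := fun u e =>
    continuous_slice (f := fun p => fderiv ℝ (fun p => f p u) p e) (fun t y hy =>
      (((hs u t y hy).fderiv_right (m := ∞) (by simp)).clm_apply contDiffAt_const).continuousAt) hy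
  have hfd : ∀ (u : Fin k → E) (e : E),
      fderiv ℝ (fun z => (∫ t in (0 : ℝ)..1, contractTime (f (t, z))) u) y e =
        ∫ t in (0 : ℝ)..1,
          fderiv ℝ (fun p => f p (Fin.cons (1, 0) fun i => (0, u i))) (t, y) (0, e) := by
    intro u e
    have he : (fun z => (∫ t in (0 : ℝ)..1, contractTime (f (t, z))) u) =ᶠ[nhds y]
        fun z => ∫ t in (0 : ℝ)..1, f (t, z) (Fin.cons (1, 0) fun i => (0, u i)) := by
      filter_upwards [hU.mem_nhds hy] with z hz using hval u z hz
    rw [he.fderiv_eq, (hasFDerivAt_parametric_integral hU (hs _) hy).fderiv]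
    refine ((ContinuousLinearMap.apply ℝ ℝ e).intervalIntegral_comp_comm ?_).symm
    refine (continuous_slice (f := fun p => (fderiv ℝ (fun p => f p
      (Fin.cons (1, 0) fun i => (0, u i))) p).comp (ContinuousLinearMap.inr ℝ ℝ E))
      (fun t y hy => ?_) hy).intervalIntegrable 0 1
    exact (((hs _ t y hy).fderiv_right (m := ∞) (by simp)).clm_comp contDiffAt_const).continuousAt
  rw [extDeriv_apply (((contDiffOn_parametric_integral hU hc).contDiffAt
    (hU.mem_nhds hy)).differentiableAt (by simp))]
  simp only [hfd]
  have hz : ∀ (i : ℕ) (a : ℝ), (-1 : ℤ) ^ i • a = (-1 : ℝ) ^ i • a := fun i a => by simp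
  simp only [hz]
  simp_rw [← intervalIntegral.integral_smul]
  have hcont' : ∀ i : Fin (k + 1), Continuous fun t : ℝ => (-1 : ℝ) ^ (i : ℕ) • fderiv ℝ
      (fun p => f p (Fin.cons (1, 0) fun j => (0, i.removeNth v j))) (t, y) (0, v i) :=
    fun i => continuous_const.mul (hcont _ _)
  rw [← intervalIntegral.integral_finsetSum fun i _ => (hcont' i).intervalIntegrable 0 1]
  have hderiv : ∀ t : ℝ, HasDerivAt (fun t => f (t, y) fun i => (0, v i))
      (∑ i : Fin (k + 1), (-1 : ℝ) ^ (i : ℕ) • fderiv ℝ (fun p => f p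
        (Fin.cons (1, 0) fun j => (0, i.removeNth v j))) (t, y) (0, v i)) t := by
    intro t
    have h0 := congrArg (fun a => a (Fin.cons (1, 0) fun i => (0, v i))) (hd t)
    change _ = (0 : ℝ) at h0
    rw [extDeriv_apply ((hf t y hy).differentiableAt (by simp)), Fin.sum_univ_succ] at h0
    have h1 : HasDerivAt (fun t => f (t, y) fun i => (0, v i))
        (fderiv ℝ (fun p => f p fun i => (0, v i)) (t, y) (1, 0)) t :=
      HasFDerivAt.comp_hasDerivAt (f := fun t : ℝ => (t, y)) t
        ((hs _ t y hy).differentiableAt (by simp)).hasFDerivAt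
        ((hasDerivAt_id t).prodMk (hasDerivAt_const t y))
    convert h1 using 1
    simp only [hz] at h0
    simp only [Fin.val_zero, pow_zero, one_smul, Fin.removeNth_zero, Fin.tail_cons, Fin.cons_zero,
      Fin.cons_succ, Fin.val_succ, pow_succ, mul_neg, mul_one, neg_smul,
      Finset.sum_neg_distrib] at h0
    rw [← sub_eq_add_neg, sub_eq_zero] at h0
    rw [h0]
    refine Finset.sum_congr rfl fun i _ => ?_
    congr 4
    funext p
    congr 1
    funext j
    refine Fin.cases ?_ (fun j => ?_) j
    · simp [Fin.removeNth]
    · simp [Fin.removeNth]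
  rw [intervalIntegral.integral_eq_sub_of_hasDerivAt (fun t _ => hderiv t)
    ((continuous_finsetSum _ fun i _ => hcont' i).intervalIntegrable 0 1)]
  rfl

end FiberIntegral

section TimeProduct

universe u

variable {E : Type u} [NormedAddCommGroup E] [NormedSpace ℝ E]
  {H : Type*} [TopologicalSpace H] {I : ModelWithCorners ℝ E H} [I.Boundaryless]
  {N : Type*} [TopologicalSpace N] [ChartedSpace H N] [IsManifold I ∞ N] {k : ℕ}

variable (I) in
/-- The derivative of the inverse of the chart at `x₀`, as an endomorphism of the model space. -/
def chartSymmDeriv (x₀ : N) (y : E) : E →L[ℝ] E :=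
  mfderiv 𝓘(ℝ, E) I (extChartAt I x₀).symm y

variable (I) in
theorem chartSymmDeriv_self (x : N) :
    chartSymmDeriv I x (extChartAt I x x) = ContinuousLinearMap.id ℝ E := by
  have : IsManifold I 1 N := .of_le (n := ∞) (by simp)
  have h := mfderivWithin_range_extChartAt_symm (I := I) (x := x)
  rwa [I.range_eq_univ, mfderivWithin_univ] at h

namespace DForm

/-- The value of a form at a point, as an alternating form on the model space. -/
def coeff (w : DForm I N k) (x : N) : E [⋀^Fin k]→L[ℝ] ℝ := w x

theorem inChart_eq_coeff (w : DForm I N k) (x₀ : N) (y : E) :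
    w.inChart x₀ y = (w.coeff ((extChartAt I x₀).symm y)).compContinuousLinearMap
      (chartSymmDeriv I x₀ y) :=
  inChart_eq w x₀ y

theorem chartSymmDeriv_time (p : ℝ × N) (t : ℝ) {y : E}
    (hy : y ∈ (extChartAt I p.2).target) :
    chartSymmDeriv (𝓘(ℝ, ℝ).prod I) p (t, y) =
      (ContinuousLinearMap.id ℝ ℝ).prodMap (chartSymmDeriv I p.2 y) := by
  have h := mfderiv_prodMap (p := ((t, y) : ℝ × E)) (mdifferentiableAt_id (I := 𝓘(ℝ, ℝ)))
    (mdifferentiableAt_extChartAt_symm (I := I) hy)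
  rw [mfderiv_id] at h
  refine Eq.trans ?_ h
  unfold chartSymmDeriv
  rw [modelWithCornersSelf_prod, ← chartedSpaceSelf_prod, extChartAt_prod,
    extChartAt_model_space_eq_id]
  rfl

theorem inChart_time (w : DForm (𝓘(ℝ, ℝ).prod I) (ℝ × N) k) (p : ℝ × N) (t : ℝ) {y : E}
    (hy : y ∈ (extChartAt I p.2).target) :
    w.inChart p (t, y) =
      (w.coeff (t, (extChartAt I p.2).symm y)).compContinuousLinearMap
        ((ContinuousLinearMap.id ℝ ℝ).prodMap (chartSymmDeriv I p.2 y)) := by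
  have hp : (extChartAt (𝓘(ℝ, ℝ).prod I) p).symm (t, y) = (t, (extChartAt I p.2).symm y) := by
    rw [extChartAt_prod, extChartAt_model_space_eq_id]; rfl
  rw [inChart_eq_coeff, hp, chartSymmDeriv_time p t hy]

theorem mem_target_time {p : ℝ × N} (t : ℝ) {y : E} :
    (t, y) ∈ (extChartAt (𝓘(ℝ, ℝ).prod I) p).target ↔ y ∈ (extChartAt I p.2).target := by
  rw [extChartAt_prod, extChartAt_model_space_eq_id]
  simp

theorem inChart_time_congr (w : DForm (𝓘(ℝ, ℝ).prod I) (ℝ × N) k) (s t : ℝ) (x : N) :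
    w.inChart (s, x) = w.inChart (t, x) := by
  unfold inChart
  rw [extChartAt_prod, extChartAt_prod, extChartAt_model_space_eq_id, extChartAt_model_space_eq_id]

/-- The integral over `[0, 1]` of the contraction of a form on `ℝ × N` with the unit vector field
of `ℝ`. -/
def fiberIntegral (w : DForm (𝓘(ℝ, ℝ).prod I) (ℝ × N) (k + 1)) : DForm I N k :=
  let c : N → E [⋀^Fin k]→L[ℝ] ℝ := fun x => ∫ t in (0 : ℝ)..1, contractTime (w.coeff (t, x))
  c

variable [FiniteDimensional ℝ E]

theorem contDiffAt_inChart_time {w : DForm (𝓘(ℝ, ℝ).prod I) (ℝ × N) k} (hw : w.IsSmooth)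
    (x : N) (t : ℝ) {y : E} (hy : y ∈ (extChartAt I x).target) :
    ContDiffAt ℝ ∞ (w.inChart (0, x)) (t, y) :=
  w.isSmooth_iff.1 hw (0, x) (t, y) ((mem_target_time t).2 hy)

theorem inChart_fiberIntegral {w : DForm (𝓘(ℝ, ℝ).prod I) (ℝ × N) (k + 1)} (hw : w.IsSmooth)
    (x : N) {y : E} (hy : y ∈ (extChartAt I x).target) :
    w.fiberIntegral.inChart x y =
      ∫ t in (0 : ℝ)..1, contractTime (w.inChart (0, x) (t, y)) := by
  have : IsManifold I 1 N := .of_le (n := ∞) (by simp)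
  set x' := (extChartAt I x).symm y with hx'
  set B : E →L[ℝ] E := chartSymmDeriv I x y with hB
  let A : E →L[ℝ] E := mfderiv I 𝓘(ℝ, E) (extChartAt I x) x'
  have hBA : B.comp A = ContinuousLinearMap.id ℝ E := by
    have h := mfderivWithin_extChartAt_symm_comp_mfderiv_extChartAt (I := I) hy
    rwa [I.range_eq_univ, mfderivWithin_univ] at h
  let a : ℝ → (ℝ × E) [⋀^Fin (k + 1)]→L[ℝ] ℝ := fun t => w.coeff (t, x')
  have hC : ∀ t, contractTime (w.inChart (0, x) (t, y)) =
      (contractTime (a t)).compContinuousLinearMap B := by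
    intro t
    rw [inChart_time w (0, x) t hy]
    ext v
    simp only [contractTime_apply, ContinuousAlternatingMap.compContinuousLinearMap_apply]
    refine congrArg (a t) (funext fun i => ?_)
    refine Fin.cases ?_ (fun i => ?_) i
    · simp
    · simp [hB]
  have hint : IntervalIntegrable (fun t => contractTime (a t)) MeasureTheory.volume 0 1 := by
    have hcont : Continuous fun t => contractTime (w.inChart (0, x) (t, y)) :=
      continuous_slice (f := fun p => contractTime (w.inChart (0, x) p))
        (fun t y hy => (contDiffAt_inChart_time hw x t hy).contractTime.continuousAt) hy
    have he : (fun t => contractTime (a t)) = fun t =>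
        ContinuousAlternatingMap.compContinuousLinearMapCLM (F := ℝ) (ι := Fin k) A
          (contractTime (w.inChart (0, x) (t, y))) := by
      funext t
      rw [hC]
      ext v
      change _ = contractTime (a t) (fun i => (B.comp A) (v i))
      rw [hBA]
      rfl
    rw [he]
    exact ((ContinuousLinearMap.continuous _).comp hcont).intervalIntegrable 0 1
  rw [inChart_eq_coeff]
  simp_rw [hC]
  exact ((ContinuousAlternatingMap.compContinuousLinearMapCLM (F := ℝ) (ι := Fin k)
    B).intervalIntegral_comp_comm hint).symm

theorem IsSmooth.fiberIntegral {w : DForm (𝓘(ℝ, ℝ).prod I) (ℝ × N) (k + 1)} (hw : w.IsSmooth) :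
    w.fiberIntegral.IsSmooth := fun x =>
  (contDiffOn_parametric_integral (isOpen_extChartAt_target x) (f := fun p =>
    contractTime (w.inChart (0, x) p)) fun t _ hy =>
    (contDiffAt_inChart_time hw x t hy).contractTime).congr fun _ hy =>
    inChart_fiberIntegral hw x hy

/-- The homotopy formula for a closed form on `ℝ × N`. -/
theorem extD_fiberIntegral {w : DForm (𝓘(ℝ, ℝ).prod I) (ℝ × N) (k + 1)} (hw : w.IsSmooth)
    (hd : w.extD = 0) :
    w.fiberIntegral.extD = pullback (I := I) (fun x => ((1 : ℝ), x)) w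
      - pullback (I := I) (fun x => ((0 : ℝ), x)) w := by
  have : IsManifold I 1 N := .of_le (n := ∞) (by simp)
  funext x
  have hx := mem_extChartAt_target (I := I) x
  have he : w.fiberIntegral.inChart x =ᶠ[nhds (extChartAt I x x)]
      fun y => ∫ t in (0 : ℝ)..1, contractTime (w.inChart (0, x) (t, y)) := by
    filter_upwards [(isOpen_extChartAt_target x).mem_nhds hx] with y hy
    exact inChart_fiberIntegral hw x hy
  have hcl : ∀ t : ℝ, extDeriv (w.inChart (0, x)) (t, extChartAt I x x) = 0 := by
    intro t
    have : IsManifold (𝓘(ℝ, ℝ).prod I) 1 (ℝ × N) := .of_le (n := ∞) (by simp)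
    have h := congrFun hd (t, x)
    rw [extD_eq, mfderiv_extChartAt_self, inChart_time_congr w t 0 x, extChartAt_prod] at h
    ext v
    exact congrArg (fun a : (ℝ × E) [⋀^Fin (k + 2)]→L[ℝ] ℝ => a v) h
  have hval : ∀ t : ℝ, ∀ v : Fin (k + 1) → E,
      w.inChart (0, x) (t, extChartAt I x x) (fun i => ((0 : ℝ), v i)) =
        (pullback (I := I) (fun x => (t, x)) w) x v := by
    intro t v
    unfold pullback
    rw [mfderiv_prod_right, inChart_time w (0, x) t hx, chartSymmDeriv_self, extChartAt_to_inv]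
    change w.coeff (t, x) _ = w.coeff (t, x) _
    refine congrArg (w.coeff (t, x)) (funext fun i => ?_)
    exact Prod.ext rfl rfl
  rw [extD_eq, he.extDeriv_eq, extDeriv_integral_contractTime (isOpen_extChartAt_target x)
    (fun t y hy => contDiffAt_inChart_time hw x t hy) hx hcl, mfderiv_extChartAt_self]
  ext v
  exact congrArg₂ (· - ·) (hval 1 v) (hval 0 v)

end DForm
end TimeProduct

/-! ### De Rham cohomology of the product with a vector space -/

section VectorProduct

variable {V : Type*} [NormedAddCommGroup V] [NormedSpace ℝ V] [FiniteDimensional ℝ V]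
  {E : Type*} [NormedAddCommGroup E] [NormedSpace ℝ E] [FiniteDimensional ℝ E]
  {H : Type*} [TopologicalSpace H] {I : ModelWithCorners ℝ E H} [I.Boundaryless]
  {M : Type*} [TopologicalSpace M] [ChartedSpace H M] [IsManifold I ∞ M]

theorem contMDiff_contraction : ContMDiff (𝓘(ℝ, ℝ).prod (𝓘(ℝ, V).prod I)) (𝓘(ℝ, V).prod I) ∞
    (fun p : ℝ × (V × M) => (p.1 • p.2.1, p.2.2)) :=
  (contMDiff_fst.smul (contMDiff_fst.comp contMDiff_snd)).prodMk
    (contMDiff_snd.comp contMDiff_snd)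

theorem deRhamVanishes_prod {q : ℕ} (h : DeRhamVanishes I M (q + 1)) :
    DeRhamVanishes (𝓘(ℝ, V).prod I) (V × M) (q + 1) := by
  intro w hw hd
  have hs : ContMDiff I (𝓘(ℝ, V).prod I) ∞ (fun m : M => ((0 : V), m)) :=
    contMDiff_const.prodMk contMDiff_id
  have hp : ContMDiff (𝓘(ℝ, V).prod I) I ∞ (Prod.snd : V × M → M) := contMDiff_snd
  have hj : ∀ t : ℝ, ContMDiff (𝓘(ℝ, V).prod I) (𝓘(ℝ, ℝ).prod (𝓘(ℝ, V).prod I)) ∞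
      (fun x : V × M => (t, x)) := fun t => contMDiff_const.prodMk contMDiff_id
  have hH := contMDiff_contraction (V := V) (M := M) (I := I)
  obtain ⟨ξ, hξ, hdξ⟩ := h (DForm.pullback (I := I) (fun m : M => ((0 : V), m)) w)
    (hw.pullback hs) (by rw [DForm.extD_pullback hw hs, hd]; rfl)
  set Θ := DForm.pullback (I := 𝓘(ℝ, ℝ).prod (𝓘(ℝ, V).prod I))
    (fun p : ℝ × (V × M) => (p.1 • p.2.1, p.2.2)) w with hΘ
  have hΘs : Θ.IsSmooth := hw.pullback hH
  have hΘd : Θ.extD = 0 := by rw [hΘ, DForm.extD_pullback hw hH, hd]; rfl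
  refine ⟨Θ.fiberIntegral + DForm.pullback (I := 𝓘(ℝ, V).prod I) Prod.snd ξ,
    hΘs.fiberIntegral.add (hξ.pullback hp), ?_⟩
  rw [DForm.extD_add hΘs.fiberIntegral (hξ.pullback hp), DForm.extD_fiberIntegral hΘs hΘd,
    DForm.extD_pullback hξ hp, hdξ, hΘ,
    ← DForm.pullback_comp (hH.mdifferentiable (by simp)) ((hj 1).mdifferentiable (by simp)),
    ← DForm.pullback_comp (hH.mdifferentiable (by simp)) ((hj 0).mdifferentiable (by simp)),
    ← DForm.pullback_comp (hs.mdifferentiable (by simp)) (hp.mdifferentiable (by simp))]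
  have h1 : (fun p : ℝ × (V × M) => (p.1 • p.2.1, p.2.2)) ∘ (fun x : V × M => ((1 : ℝ), x)) =
      id := by
    funext x; simp
  have h0 : (fun p : ℝ × (V × M) => (p.1 • p.2.1, p.2.2)) ∘ (fun x : V × M => ((0 : ℝ), x)) =
      (fun m : M => ((0 : V), m)) ∘ Prod.snd := by
    funext x; simp
  rw [h1, h0, DForm.pullback_id, sub_add_cancel]

end VectorProduct

/-! ### Functions as forms of degree zero -/

section ZeroForms

variable {E : Type*} [NormedAddCommGroup E] [NormedSpace ℝ E]
  {H : Type*} [TopologicalSpace H] {I : ModelWithCorners ℝ E H} [I.Boundaryless]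
  {M : Type*} [TopologicalSpace M] [ChartedSpace H M]

namespace DForm

theorem not_deRhamVanishes_zero [Nonempty M] : ¬ DeRhamVanishes I M 0 := by
  intro h
  let w : DForm I M 0 := fun x => ContinuousAlternatingMap.constOfIsEmpty ℝ (TangentSpace I x)
    (Fin 0) (1 : ℝ)
  have hc : ∀ x₀, w.inChart x₀ =
      fun _ => ContinuousAlternatingMap.constOfIsEmpty ℝ E (Fin 0) (1 : ℝ) := fun _ => rfl
  have hw : w = 0 := by
    refine h w (fun x₀ => by rw [hc]; exact contDiffOn_const) ?_
    funext x
    have h0 : extDeriv (w.inChart x) (extChartAt I x x) = 0 := by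
      rw [hc, extDeriv_constOfIsEmpty, fderiv_const_apply]
      rfl
    rw [extD_eq, h0]
    rfl
  obtain ⟨x⟩ := ‹Nonempty M›
  exact one_ne_zero (congrArg (fun a => a ![]) (congrFun hw x) : (1 : ℝ) = 0)

variable [IsManifold I ∞ M]

theorem hasMFDerivAt_zero_of_extD_eq_zero {w : DForm I M 0} (hw : w.IsSmooth) (hd : w.extD = 0)
    (x : M) : HasMFDerivAt I 𝓘(ℝ, ℝ) (fun y => w y ![]) x 0 := by
  have : IsManifold I 1 M := .of_le (n := ∞) (by simp)
  have hdx : extDeriv (w.inChart x) (extChartAt I x x) = 0 := by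
    have h := congrFun hd x
    rw [extD_eq, mfderiv_extChartAt_self] at h
    ext v
    exact congrArg (fun a : E [⋀^Fin 1]→L[ℝ] ℝ => a v) h
  have hg : HasFDerivAt (fun y => w.inChart x y ![]) (0 : E →L[ℝ] ℝ) (extChartAt I x x) := by
    have hdiff := ((hw.contDiffAt x).alternating_apply ![]).differentiableAt (by simp)
    suffices hz : fderiv ℝ (fun y => w.inChart x y ![]) (extChartAt I x x) = 0 from
      hz ▸ hdiff.hasFDerivAt
    refine ContinuousLinearMap.ext fun e => ?_
    have h := congrArg (fun a : E [⋀^Fin 1]→L[ℝ] ℝ => a fun _ => e) hdx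
    simp only [extDeriv_apply ((hw.contDiffAt x).differentiableAt (by simp))] at h
    refine Eq.trans ?_ h
    rw [Fin.sum_univ_succ, Finset.univ_eq_empty, Finset.sum_empty, add_zero, Fin.val_zero,
      pow_zero, one_smul]
    congr 2
    funext y
    congr 1
    exact Subsingleton.elim _ _
  have hc := hg.hasMFDerivAt.comp x (mdifferentiableAt_extChartAt_of_mem
    (mem_extChartAt_source (I := I) x)).hasMFDerivAt
  have hz : ContinuousLinearMap.comp (0 : E →L[ℝ] ℝ) (mfderiv I 𝓘(ℝ, E) (extChartAt I x) x) = 0 :=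
    ContinuousLinearMap.zero_comp _
  refine (hz ▸ hc).congr_of_eventuallyEq ?_
  filter_upwards [extChartAt_source_mem_nhds (I := I) x] with y hy
  have hinv := (extChartAt I x).left_inv hy
  change _ = w.inChart x (extChartAt I x y) ![]
  rw [inChart_eq, hinv]
  change _ = w y _
  congr 1
  exact Subsingleton.elim _ _

/-- A closed form of degree zero on a connected manifold is constant. -/
theorem apply_eq_of_extD_eq_zero [ConnectedSpace M] {w : DForm I M 0} (hw : w.IsSmooth)
    (hd : w.extD = 0) (x y : M) : w x ![] = w y ![] := by
  refine IsLocallyConstant.apply_eq_of_preconnectedSpace (f := fun y => w y ![]) ?_ x y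
  rw [IsLocallyConstant.iff_eventually_eq]
  intro x₀
  have hx := mem_extChartAt_target (I := I) x₀
  obtain ⟨ε, hε, hball⟩ := Metric.isOpen_iff.1 (isOpen_extChartAt_target (I := I) x₀) _ hx
  have hderiv : ∀ y ∈ Metric.ball (extChartAt I x₀ x₀) ε,
      HasFDerivAt (fun y => w ((extChartAt I x₀).symm y) ![]) (0 : E →L[ℝ] ℝ) y := by
    intro y hy
    have h := (hasMFDerivAt_zero_of_extD_eq_zero hw hd ((extChartAt I x₀).symm y)).comp y
      (mdifferentiableAt_extChartAt_symm (hball hy)).hasMFDerivAt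
    rw [ContinuousLinearMap.zero_comp] at h
    exact h.hasFDerivAt
  have hpre : (extChartAt I x₀) ⁻¹' Metric.ball (extChartAt I x₀ x₀) ε ∈ nhds x₀ :=
    (continuousAt_extChartAt x₀).preimage_mem_nhds (Metric.ball_mem_nhds _ hε)
  filter_upwards [extChartAt_source_mem_nhds (I := I) x₀, hpre] with z hz hzb
  have h := Metric.isOpen_ball.is_const_of_fderiv_eq_zero (𝕜 := ℝ)
    (convex_ball (extChartAt I x₀ x₀) ε).isPreconnected
    (fun y hy => (hderiv y hy).differentiableAt.differentiableWithinAt)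
    (fun y hy => (hderiv y hy).fderiv) hzb (Metric.mem_ball_self hε)
  rwa [(extChartAt I x₀).left_inv hz, extChartAt_to_inv] at h

end DForm

end ZeroForms

/-! ### The differential of nonhomogeneous cochains -/

section CochainDifferential

variable {G A : Type*} [Group G] [AddCommGroup A] {act : A → G → A}

/-- The homogeneous cochain that corresponds to a nonhomogeneous cochain. -/
def homogenize (act : A → G → A) {p : ℕ} (f : (Fin p → G) → A) (g : Fin (p + 1) → G) : A :=
  act (f fun i => g i.castSucc * (g i.succ)⁻¹) (g (Fin.last p))

theorem contractNth_mul_inv {p : ℕ} (g : Fin (p + 2) → G) (i : Fin p) :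
    i.castSucc.contractNth (· * ·) (fun j : Fin (p + 1) => g j.castSucc * (g j.succ)⁻¹) =
      fun j => g (i.castSucc.succ.succAbove j.castSucc) * (g (i.castSucc.succ.succAbove j.succ))⁻¹ := by
  funext j
  rcases lt_trichotomy (j : ℕ) (i : ℕ) with h | h | h
  · rw [Fin.contractNth_apply_of_lt _ _ _ _ (by simpa using h),
      Fin.succAbove_of_castSucc_lt _ _ (by simp only [Fin.lt_def, Fin.val_castSucc, Fin.val_succ]; omega),
      Fin.succAbove_of_castSucc_lt _ _ (by simp only [Fin.lt_def, Fin.val_castSucc, Fin.val_succ]; omega)]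
    rfl
  · rw [Fin.contractNth_apply_of_eq _ _ _ _ (by simpa using h),
      Fin.succAbove_of_castSucc_lt _ _ (by simp only [Fin.lt_def, Fin.val_castSucc, Fin.val_succ]; omega),
      Fin.succAbove_of_le_castSucc _ _ (by simp only [Fin.le_def, Fin.val_castSucc, Fin.val_succ]; omega)]
    simp
  · rw [Fin.contractNth_apply_of_gt _ _ _ _ (by simpa using h),
      Fin.succAbove_of_le_castSucc _ _ (by simp only [Fin.le_def, Fin.val_castSucc, Fin.val_succ]; omega),
      Fin.succAbove_of_le_castSucc _ _ (by simp only [Fin.le_def, Fin.val_castSucc, Fin.val_succ]; omega)]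
    rfl

variable (hadd : ∀ a b g, act (a + b) g = act a g + act b g)
include hadd

theorem act_zsmul (n : ℤ) (a : A) (g : G) : act (n • a) g = n • act a g :=
  map_zsmul (AddMonoidHom.mk' (fun a => act a g) fun a b => hadd a b g) n a

theorem act_sum {ι : Type*} (s : Finset ι) (f : ι → A) (g : G) :
    act (∑ i ∈ s, f i) g = ∑ i ∈ s, act (f i) g :=
  map_sum (AddMonoidHom.mk' (fun a => act a g) fun a b => hadd a b g) f s

theorem cochainD_add {p : ℕ} (f f' : (Fin p → G) → A) :
    cochainD act (f + f') = cochainD act f + cochainD act f' := by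
  funext g
  simp only [cochainD, Pi.add_apply, hadd, smul_add, Finset.sum_add_distrib]
  abel

theorem cochainD_zsmul {p : ℕ} (n : ℤ) (f : (Fin p → G) → A) :
    cochainD act (n • f) = n • cochainD act f := by
  funext g
  simp only [cochainD, Pi.smul_apply, act_zsmul hadd, smul_add, Finset.smul_sum,
    smul_comm n]

theorem cochainD_neg {p : ℕ} (f : (Fin p → G) → A) : cochainD act (-f) = -cochainD act f := by
  simpa using cochainD_zsmul hadd (-1) f

theorem cochainD_sub {p : ℕ} (f f' : (Fin p → G) → A) :
    cochainD act (f - f') = cochainD act f - cochainD act f' := by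
  rw [sub_eq_add_neg, cochainD_add hadd, cochainD_neg hadd, sub_eq_add_neg]

variable (hmul : ∀ a g h, act a (g * h) = act (act a g) h)
include hmul

theorem homogenize_cochainD {p : ℕ} (f : (Fin p → G) → A) (g : Fin (p + 2) → G) :
    homogenize act (cochainD act f) g =
      ∑ i : Fin (p + 2), (-1 : ℤ) ^ (i : ℕ) • homogenize act f fun j => g (i.succAbove j) := by
  rw [Fin.sum_univ_succ, Fin.sum_univ_castSucc]
  simp only [homogenize, cochainD, hadd, act_zsmul hadd, act_sum hadd]
  rw [add_assoc]
  congr 1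
  · simp only [Fin.val_zero, pow_zero, one_smul, Fin.succAbove_zero]
    rfl
  · congr 1
    · refine Finset.sum_congr rfl fun i _ => ?_
      rw [contractNth_mul_inv]
      have h : i.castSucc.succ.succAbove (Fin.last p) = Fin.last (p + 1) := by
        rw [Fin.succAbove_of_le_castSucc _ _
          (by simp only [Fin.le_def, Fin.val_castSucc, Fin.val_succ, Fin.val_last]; omega)]
        rfl
      rw [h]
      rfl
    · rw [← hmul]
      simp only [Fin.succ_last, Fin.succAbove_last, inv_mul_cancel_right]
      rfl

variable (hone : ∀ a, act a 1 = a)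
include hone

theorem cochainD_cochainD {p : ℕ} (f : (Fin p → G) → A) : cochainD act (cochainD act f) = 0 := by
  funext h
  let g : Fin (p + 3) → G := fun i => (Fin.partialProd h i)⁻¹
  have hg : (fun i : Fin (p + 2) => g i.castSucc * (g i.succ)⁻¹) = h := by
    funext i
    simp only [g, inv_inv]
    exact Fin.partialProd_right_inv h i
  have key : homogenize act (cochainD act (cochainD act f)) g = 0 := by
    rw [homogenize_cochainD hadd hmul]
    simp only [homogenize_cochainD hadd hmul, Finset.smul_sum, smul_smul, ← pow_add]
    rw [← Finset.sum_product']
    refine Finset.sum_involution (fun a _ => (a.1.succAbove a.2, a.2.predAbove a.1)) ?_ ?_ ?_ ?_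
    · rintro ⟨i, j⟩ -
      simp only [Fin.succAbove_succAbove_succAbove_predAbove,
        Fin.neg_one_pow_succAbove_add_predAbove, neg_smul, add_neg_cancel]
    · rintro ⟨i, j⟩ - - h
      exact Fin.succAbove_ne i j (congrArg Prod.fst h)
    · exact fun _ _ => Finset.mem_univ _
    · rintro ⟨i, j⟩ -
      exact Prod.ext (Fin.succAbove_succAbove_predAbove i j)
        (Fin.predAbove_predAbove_succAbove i j)
  unfold homogenize at key
  rw [hg] at key
  have h1 := hmul (cochainD act (cochainD act f) h) (g (Fin.last _)) (g (Fin.last _))⁻¹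
  rw [mul_inv_cancel, hone, key] at h1
  rw [h1]
  exact map_zero (AddMonoidHom.mk' (fun a => act a (g (Fin.last _))⁻¹) fun a b => hadd a b _)

end CochainDifferential

/-! ### Cochains with trivial coefficients -/

section TrivialCoefficients

theorem contractNth_add {V : Type*} [AddCommGroup V] {p : ℕ} (v : Fin (p + 1) → V) (i : Fin p) :
    i.castSucc.contractNth (· + ·) v =
      Function.update (i.succ.removeNth v) i (v i.castSucc + v i.succ) := by
  funext j
  rcases lt_trichotomy (j : ℕ) (i : ℕ) with h | h | h
  · rw [Fin.contractNth_apply_of_lt _ _ _ _ (by simpa using h),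
      Function.update_of_ne (Fin.ne_of_lt h), Fin.removeNth,
      Fin.succAbove_of_castSucc_lt _ _ (by simp only [Fin.lt_def, Fin.val_castSucc, Fin.val_succ]; omega)]
  · obtain rfl : j = i := Fin.ext h
    rw [Fin.contractNth_apply_of_eq _ _ _ _ (by simp), Function.update_self]
  · rw [Fin.contractNth_apply_of_gt _ _ _ _ (by simpa using h),
      Function.update_of_ne (Fin.ne_of_gt h), Fin.removeNth,
      Fin.succAbove_of_le_castSucc _ _ (by simp only [Fin.le_def, Fin.val_castSucc, Fin.val_succ]; omega)]

theorem MultilinearMap.map_contractNth_add {V W : Type*} [AddCommGroup V] [Module ℝ V]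
    [AddCommGroup W] [Module ℝ W] {p : ℕ} (f : MultilinearMap ℝ (fun _ : Fin p => V) W)
    (v : Fin (p + 1) → V) (i : Fin p) :
    f (i.castSucc.contractNth (· + ·) v) = f (i.succ.removeNth v) + f (i.castSucc.removeNth v) := by
  rw [contractNth_add, f.map_update_add]
  congr 2
  · rw [Function.update_eq_self_iff, Fin.removeNth, Fin.succAbove_of_castSucc_lt _ _ (by simp)]
  · funext j
    by_cases hj : j = i
    · subst hj
      rw [Function.update_self, Fin.removeNth, Fin.succAbove_of_le_castSucc _ _ (by simp)]
    · rw [Function.update_of_ne hj, Fin.removeNth, Fin.removeNth]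
      congr 1
      rcases lt_or_gt_of_ne hj with h | h
      · rw [Fin.succAbove_of_castSucc_lt _ _ (by simp only [Fin.lt_def, Fin.val_castSucc, Fin.val_succ] at h ⊢; omega),
          Fin.succAbove_of_castSucc_lt _ _ (by simpa using h)]
      · rw [Fin.succAbove_of_le_castSucc _ _ (by
          simp only [Fin.lt_def, Fin.le_def, Fin.val_castSucc, Fin.val_succ] at h ⊢; omega),
          Fin.succAbove_of_le_castSucc _ _ (by
          simp only [Fin.lt_def, Fin.le_def, Fin.val_castSucc] at h ⊢; omega)]

/-- Multilinear functions are cocycles of the additive group, for trivial coefficients. -/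
theorem MultilinearMap.cocycle_identity {V W : Type*} [AddCommGroup V] [Module ℝ V]
    [AddCommGroup W] [Module ℝ W] {p : ℕ} (f : MultilinearMap ℝ (fun _ : Fin p => V) W)
    (v : Fin (p + 1) → V) :
    f (Fin.tail v) + ∑ i : Fin p, (-1 : ℤ) ^ ((i : ℕ) + 1) • f (i.castSucc.contractNth (· + ·) v)
      + (-1 : ℤ) ^ (p + 1) • f (Fin.init v) = 0 := by
  simp only [f.map_contractNth_add, smul_add, Finset.sum_add_distrib]
  have h1 := Fin.sum_univ_succ fun i : Fin (p + 1) => (-1 : ℤ) ^ (i : ℕ) • f (i.removeNth v)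
  have h2 := Fin.sum_univ_castSucc fun i : Fin (p + 1) => (-1 : ℤ) ^ (i : ℕ) • f (i.removeNth v)
  simp only [Fin.val_zero, pow_zero, one_smul, Fin.removeNth_zero, Fin.removeNth_last,
    Fin.val_succ, Fin.val_castSucc, Fin.val_last] at h1 h2
  have h3 : ∑ i : Fin p, (-1 : ℤ) ^ ((i : ℕ) + 1) • f (i.castSucc.removeNth v) =
      -∑ i : Fin p, (-1 : ℤ) ^ (i : ℕ) • f (i.castSucc.removeNth v) := by
    rw [← Finset.sum_neg_distrib]
    exact Finset.sum_congr rfl fun i _ => by rw [pow_succ, mul_neg_one, neg_smul]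
  rw [h3, pow_succ, mul_neg_one, neg_smul]
  have h4 := h1.symm.trans h2
  rw [← add_assoc, h4]
  abel

/-- The alternation of a coboundary of a commutative group vanishes. -/
theorem sum_sign_realD_eq_zero {G : Type*} [Group G] (hcomm : ∀ g h : G, g * h = h * g) {p : ℕ}
    (b : (Fin p → G) → ℝ) (g : Fin (p + 1) → G) :
    ∑ σ : Equiv.Perm (Fin (p + 1)), (Equiv.Perm.sign σ : ℤ) • realD b (fun i => g (σ i)) = 0 := by
  have hmid : ∀ i : Fin p, ∑ σ : Equiv.Perm (Fin (p + 1)), (Equiv.Perm.sign σ : ℤ) •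
      b (i.castSucc.contractNth (· * ·) fun j => g (σ j)) = 0 := by
    intro i
    have hne : i.castSucc ≠ i.succ := (Fin.castSucc_lt_succ).ne
    have h := Equiv.sum_comp (Equiv.mulRight (Equiv.swap i.castSucc i.succ))
      fun σ : Equiv.Perm (Fin (p + 1)) => (Equiv.Perm.sign σ : ℤ) •
      b (i.castSucc.contractNth (· * ·) fun j => g (σ j))
    have hc : ∀ σ : Equiv.Perm (Fin (p + 1)),
        (i.castSucc.contractNth (· * ·) fun j => g ((σ * Equiv.swap i.castSucc i.succ) j)) =
        i.castSucc.contractNth (· * ·) fun j => g (σ j) := by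
      intro σ
      funext j
      rcases lt_trichotomy (j : ℕ) (i : ℕ) with h | h | h
      · rw [Fin.contractNth_apply_of_lt _ _ _ _ (by simpa using h),
          Fin.contractNth_apply_of_lt _ _ _ _ (by simpa using h), Equiv.Perm.mul_apply,
          Equiv.swap_apply_of_ne_of_ne (by simp [Fin.ext_iff]; omega)
            (by simp [Fin.ext_iff]; omega)]
      · obtain rfl : j = i := Fin.ext h
        rw [Fin.contractNth_apply_of_eq _ _ _ _ (by simp),
          Fin.contractNth_apply_of_eq _ _ _ _ (by simp), Equiv.Perm.mul_apply,
          Equiv.Perm.mul_apply, Equiv.swap_apply_left, Equiv.swap_apply_right, hcomm]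
      · rw [Fin.contractNth_apply_of_gt _ _ _ _ (by simpa using h),
          Fin.contractNth_apply_of_gt _ _ _ _ (by simpa using h), Equiv.Perm.mul_apply,
          Equiv.swap_apply_of_ne_of_ne (by simp [Fin.ext_iff]; omega)
            (by simp [Fin.ext_iff]; omega)]
    simp only [Equiv.coe_mulRight, hc, Equiv.Perm.sign_mul, Equiv.Perm.sign_swap hne, mul_neg,
      mul_one, Units.val_neg, neg_smul, Finset.sum_neg_distrib] at h
    linarith
  have hrot : ∑ σ : Equiv.Perm (Fin (p + 1)), (Equiv.Perm.sign σ : ℤ) •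
      b (Fin.init fun j => g (σ j)) = (-1 : ℤ) ^ p •
      ∑ σ : Equiv.Perm (Fin (p + 1)), (Equiv.Perm.sign σ : ℤ) •
      b (Fin.tail fun j => g (σ j)) := by
    rw [← Equiv.sum_comp (Equiv.mulRight (finRotate (p + 1))), Finset.smul_sum]
    refine Finset.sum_congr rfl fun σ _ => ?_
    have hc : (Fin.init fun j => g ((σ * finRotate (p + 1)) j)) =
        Fin.tail fun j => g (σ j) := by
      funext j
      simp [Fin.init, Fin.tail]
    simp only [Equiv.coe_mulRight, hc, Equiv.Perm.sign_mul, sign_finRotate, Units.val_mul,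
      Units.val_pow_eq_pow_val, Units.val_neg, Units.val_one, smul_smul]
    rw [mul_comm, Nat.add_sub_cancel]
  simp only [realD, cochainD, smul_add, Finset.sum_add_distrib, Finset.smul_sum]
  rw [Finset.sum_comm]
  simp only [smul_comm _ ((-1 : ℤ) ^ _)]
  simp only [← Finset.smul_sum]
  have hodd : (-1 : ℤ) ^ (p + 1 + p) = -1 := Odd.neg_one_pow ⟨p, by ring⟩
  simp only [hmid, smul_zero, Finset.sum_const_zero, add_zero]
  rw [hrot, smul_smul, ← pow_add, hodd, neg_one_smul, add_neg_cancel]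

end TrivialCoefficients

/-! ### Descent -/

section Descent

variable {E : Type*} [NormedAddCommGroup E] [NormedSpace ℝ E] [FiniteDimensional ℝ E]
  {H : Type*} [TopologicalSpace H] {I : ModelWithCorners ℝ E H} [I.Boundaryless]
  {M : Type*} [TopologicalSpace M] [ChartedSpace H M] [IsManifold I ∞ M]
  {G : Subgroup (M ≃ₘ⟮I, I⟯ M)} {p q : ℕ}

theorem delta₁_sub (c c' : (Fin p → G) → DForm I M q) :
    delta₁ (c - c') = delta₁ c - delta₁ c' :=
  cochainD_sub (fun _ _ _ => rfl) c c'

theorem delta₁_zsmul (n : ℤ) (c : (Fin p → G) → DForm I M q) :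
    delta₁ (n • c) = n • delta₁ c :=
  cochainD_zsmul (fun _ _ _ => rfl) n c

theorem delta₁_delta₁ (c : (Fin p → G) → DForm I M q) : delta₁ (delta₁ c) = 0 :=
  cochainD_cochainD (fun _ _ _ => rfl)
    (fun w (g h : G) => DForm.pullback_mul (g : M ≃ₘ⟮I, I⟯ M) h w) (fun w => w.pullback_one) c

theorem isSmooth_delta₁ {c : (Fin p → G) → DForm I M q} (hc : ∀ g, (c g).IsSmooth)
    (g : Fin (p + 1) → G) : (delta₁ c g).IsSmooth :=
  ((hc _).add (DForm.IsSmooth.sum _ fun _ _ => (hc _).zsmul _)).add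
    (((hc _).pullback (Diffeomorph.contMDiff _)).zsmul _)

theorem extD_delta₁ {c : (Fin p → G) → DForm I M q} (hc : ∀ g, (c g).IsSmooth)
    (g : Fin (p + 1) → G) : (delta₁ c g).extD = delta₁ (fun h => (c h).extD) g := by
  have h1 : (DForm.pullback (I := I) (⇑(g (Fin.last p) : M ≃ₘ⟮I, I⟯ M)) (c (Fin.init g))).IsSmooth :=
    (hc _).pullback (Diffeomorph.contMDiff _)
  have h2 : (∑ i : Fin p, (-1 : ℤ) ^ ((i : ℕ) + 1) •
      c (i.castSucc.contractNth (· * ·) g)).IsSmooth :=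
    DForm.IsSmooth.sum _ fun _ _ => (hc _).zsmul _
  unfold delta₁ cochainD
  rw [DForm.extD_add ((hc _).add h2) (h1.zsmul _), DForm.extD_add (hc _) h2,
    DForm.extD_sum _ fun _ _ => (hc _).zsmul _, DForm.extD_zsmul,
    DForm.extD_pullback (hc _) (Diffeomorph.contMDiff _)]
  simp only [DForm.extD_zsmul]

theorem exists_delta₂_eq (hv : DeRhamVanishes I M (q + 1)) {c : (Fin p → G) → DForm I M (q + 1)}
    (hc : ∀ g, (c g).IsSmooth) (hd : ∀ g, (c g).extD = 0) :
    ∃ b : (Fin p → G) → DForm I M q, (∀ g, (b g).IsSmooth) ∧ delta₂ b = c := by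
  choose b hb hbd using fun g => hv (c g) (hc g) (hd g)
  refine ⟨fun g => (-1 : ℤ) ^ p • b g, fun g => (hb g).zsmul _, ?_⟩
  funext g
  rw [delta₂, DForm.extD_zsmul, hbd, smul_smul, ← pow_add, Even.neg_one_pow ⟨p, rfl⟩, one_smul]

theorem extD_eq_zsmul_delta₂ (c : (Fin p → G) → DForm I M q) (g : Fin p → G) :
    (c g).extD = (-1 : ℤ) ^ p • delta₂ c g := by
  rw [delta₂, smul_smul, ← pow_add, Even.neg_one_pow ⟨p, rfl⟩, one_smul]

theorem delta₁_delta₂ {c : (Fin p → G) → DForm I M q} (hc : ∀ g, (c g).IsSmooth) :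
    delta₁ (delta₂ c) = -delta₂ (delta₁ c) := by
  have h : delta₂ c = (-1 : ℤ) ^ p • fun g => (c g).extD := rfl
  rw [h, delta₁_zsmul]
  funext g
  rw [Pi.neg_apply, delta₂, extD_delta₁ hc, pow_succ, mul_neg_one, neg_smul, neg_neg]
  rfl

theorem delta₁_const {w : DForm I M q}
    (hw : ∀ g ∈ G, DForm.pullback (I := I) (⇑g) w = w) :
    delta₁ (fun _ : Fin 0 → G => w) = 0 := by
  funext g
  have h := hw _ (g (Fin.last 0)).2
  change w + _ + (-1 : ℤ) ^ (0 + 1) • DForm.pullback (I := I) _ w = 0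
  rw [h]
  simp

/-- The value at a point of `δ'c`, for a cochain `c` of constant functions. -/
theorem delta₁_apply_of_const {c : (Fin p → G) → DForm I M 0} (x : M)
    (hc : ∀ g y, c g y ![] = c g x ![]) (g : Fin (p + 1) → G) :
    delta₁ c g x ![] = realD (fun h => c h x ![]) g := by
  let ev : DForm I M 0 →+ ℝ := AddMonoidHom.mk' (fun w => w x ![]) fun _ _ => rfl
  have hpull : ev (DForm.pullback (I := I) (⇑(g (Fin.last p) : M ≃ₘ⟮I, I⟯ M)) (c (Fin.init g))) =
      c (Fin.init g) x ![] := by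
    rw [← hc (Fin.init g) ((g (Fin.last p) : M ≃ₘ⟮I, I⟯ M) x)]
    change c (Fin.init g) _ _ = _
    congr 1
    exact Subsingleton.elim _ _
  change ev (delta₁ c g) = _
  unfold delta₁ realD cochainD
  rw [map_add, map_add, map_sum, map_zsmul, hpull]
  simp only [map_zsmul]
  rfl

theorem zsmul_neg_sub_sub_eq_zero {A : Type*} [AddCommGroup A] (n : ℤ) {a b c : A}
    (h : a - b = -c) : n • (-a) - n • (-b) - n • c = 0 := by
  rw [← smul_sub, ← smul_sub, neg_sub_neg, ← neg_sub a b, h, neg_neg, sub_self, smul_zero]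

theorem extD_delta₁_of_base {w : DForm I M (q + 1)}
    (hw : ∀ g ∈ G, DForm.pullback (I := I) (⇑g) w = w) {c : (Fin 0 → G) → DForm I M q}
    (hc : ∀ g, (c g).IsSmooth) (hb : ∀ g, w = -(c g).extD) (g : Fin 1 → G) :
    (delta₁ c g).extD = 0 := by
  have h : (fun h => (c h).extD) = (-1 : ℤ) • fun _ : Fin 0 → G => w := by
    funext h
    simp [hb h]
  rw [extD_delta₁ hc, h, delta₁_zsmul, delta₁_const hw, smul_zero]
  rfl

theorem extD_delta₁_of_step {c : (Fin p → G) → DForm I M (q + 1)}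
    {c' : (Fin (p + 1) → G) → DForm I M q} (hc' : ∀ g, (c' g).IsSmooth)
    (h : delta₁ c + delta₂ c' = 0) (g : Fin (p + 2) → G) : (delta₁ c' g).extD = 0 := by
  have h' : (fun h => (c' h).extD) = (-1 : ℤ) ^ (p + 1) • (-1 : ℤ) • delta₁ c := by
    funext g
    rw [extD_eq_zsmul_delta₂, eq_neg_of_add_eq_zero_right h]
    simp
  rw [extD_delta₁ hc', h', delta₁_zsmul, delta₁_zsmul, delta₁_delta₁, smul_zero, smul_zero]
  rfl

namespace IsDescent

variable {k : ℕ} {w : DForm I M (k + 1)} {φ ψ : ∀ i j : ℕ, (Fin i → G) → DForm I M j}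

theorem extD_delta₁_eq_zero (hinv : ∀ g ∈ G, DForm.pullback (I := I) (⇑g) w = w)
    (hφ : IsDescent G w φ) {i j : ℕ} (hij : i + j = k) (g : Fin (i + 1) → G) :
    (delta₁ (φ i j) g).extD = 0 := by
  cases i with
  | zero =>
    obtain rfl : j = k := by omega
    exact extD_delta₁_of_base hinv (hφ.smooth 0 j hij) hφ.base g
  | succ i => exact extD_delta₁_of_step (hφ.smooth _ j hij) (hφ.step i j hij) g

theorem pointCocycle_eq [ConnectedSpace M]
    (hinv : ∀ g ∈ G, DForm.pullback (I := I) (⇑g) w = w)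
    (hφ : IsDescent G w φ) (x y : M) : pointCocycle G k φ y = pointCocycle G k φ x := by
  funext g
  exact DForm.apply_eq_of_extD_eq_zero (isSmooth_delta₁ (hφ.smooth k 0 rfl) g)
    (hφ.extD_delta₁_eq_zero hinv rfl g) y x

theorem isRealCocycle [ConnectedSpace M]
    (hinv : ∀ g ∈ G, DForm.pullback (I := I) (⇑g) w = w)
    (hφ : IsDescent G w φ) (x : M) : IsRealCocycle (pointCocycle G k φ x) := by
  funext g
  have h := delta₁_apply_of_const (c := delta₁ (φ k 0)) x
    (fun g y => congrFun (hφ.pointCocycle_eq hinv x y) g) g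
  rw [delta₁_delta₁] at h
  exact h.symm

theorem exists_closed_delta₁_eq (hv : ∀ q, 1 ≤ q → q ≤ k → DeRhamVanishes I M q)
    (hφ : IsDescent G w φ) (hψ : IsDescent G w ψ) (i j : ℕ) (hij : i + j = k) :
    ∃ c : (Fin i → G) → DForm I M j, (∀ g, (c g).IsSmooth) ∧ (∀ g, (c g).extD = 0) ∧
      delta₁ c = delta₁ (φ i j) - delta₁ (ψ i j) := by
  induction i generalizing j with
  | zero =>
    obtain rfl : j = k := by omega
    refine ⟨φ 0 j - ψ 0 j, fun g => (hφ.smooth 0 j hij g).sub (hψ.smooth 0 j hij g), fun g => ?_,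
      delta₁_sub _ _⟩
    rw [Pi.sub_apply, DForm.extD_sub (hφ.smooth 0 j hij g) (hψ.smooth 0 j hij g), sub_eq_zero]
    exact neg_injective ((hφ.base g).symm.trans (hψ.base g))
  | succ i ih =>
    obtain ⟨c, hc, hcd, hcδ⟩ := ih (j + 1) (by omega)
    obtain ⟨b, hb, hbc⟩ := exists_delta₂_eq (hv (j + 1) (by omega) (by omega)) hc hcd
    have hsm : ∀ g, (φ (i + 1) j g - ψ (i + 1) j g).IsSmooth := fun g =>
      (hφ.smooth _ _ hij g).sub (hψ.smooth _ _ hij g)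
    refine ⟨φ (i + 1) j - ψ (i + 1) j - delta₁ b, fun g => (hsm g).sub (isSmooth_delta₁ hb g),
      fun g => ?_, ?_⟩
    · have h1 := congrFun (eq_neg_of_add_eq_zero_right (hφ.step i j hij)) g
      have h2 := congrFun (eq_neg_of_add_eq_zero_right (hψ.step i j hij)) g
      have h3 := congrFun (delta₁_delta₂ hb) g
      rw [hbc, hcδ] at h3
      simp only [Pi.sub_apply, Pi.neg_apply] at h1 h2 h3 ⊢
      rw [DForm.extD_sub (hsm g) (isSmooth_delta₁ hb g),
        DForm.extD_sub (hφ.smooth _ _ hij g) (hψ.smooth _ _ hij g),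
        extD_eq_zsmul_delta₂, extD_eq_zsmul_delta₂, extD_eq_zsmul_delta₂ (delta₁ b), h1, h2]
      exact zsmul_neg_sub_sub_eq_zero _ h3
    · rw [delta₁_sub, delta₁_sub, delta₁_delta₁, sub_zero]

theorem isRealCoboundary_sub [ConnectedSpace M]
    (hv : ∀ q, 1 ≤ q → q ≤ k → DeRhamVanishes I M q)
    (hφ : IsDescent G w φ) (hψ : IsDescent G w ψ) (x : M) :
    IsRealCoboundary (pointCocycle G k φ x - pointCocycle G k ψ x) := by
  obtain ⟨c, hc, hcd, hcδ⟩ := exists_closed_delta₁_eq hv hφ hψ k 0 rfl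
  refine ⟨fun g => c g x ![], funext fun g => ?_⟩
  rw [← delta₁_apply_of_const x
    (fun g y => DForm.apply_eq_of_extD_eq_zero (hc g) (hcd g) y x), hcδ]
  rfl

open Classical in
/-- The rows of a descent, chosen one after the other, starting with `φ₀`. -/
def rows (φ₀ : DForm I M k) : ∀ i j : ℕ, (Fin i → G) → DForm I M j
  | 0 => Function.update (fun _ _ => 0) k fun _ => φ₀
  | i + 1 => fun j =>
    if h : ∃ c : (Fin (i + 1) → G) → DForm I M j, (∀ g, (c g).IsSmooth) ∧
        delta₁ (rows φ₀ i (j + 1)) + delta₂ c = 0 then h.choose else 0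

theorem exists_isDescent (hv : ∀ q, 1 ≤ q → q ≤ k → DeRhamVanishes I M q)
    (hinv : ∀ g ∈ G, DForm.pullback (I := I) (⇑g) w = w) (hex : w.IsExact) :
    ∃ φ, IsDescent G w φ := by
  obtain ⟨η, hη, hηw⟩ := hex
  let φ : ∀ i j : ℕ, (Fin i → G) → DForm I M j := rows (-η)
  have h0 : φ 0 k = fun _ => -η := by simp [φ, rows]
  have hsucc : ∀ i j : ℕ, i + 1 + j = k → (∀ g, (φ i (j + 1) g).IsSmooth) →
      (∀ g, (delta₁ (φ i (j + 1)) g).extD = 0) → (∀ g, (φ (i + 1) j g).IsSmooth) ∧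
        delta₁ (φ i (j + 1)) + delta₂ (φ (i + 1) j) = 0 := by
    intro i j hij hs hd
    obtain ⟨b, hb, hbδ⟩ := exists_delta₂_eq (hv (j + 1) (by omega) (by omega))
      (c := -delta₁ (φ i (j + 1))) (fun g => (isSmooth_delta₁ hs g).neg)
      (fun g => by rw [Pi.neg_apply, DForm.extD_neg, hd, neg_zero])
    have hex : ∃ c : (Fin (i + 1) → G) → DForm I M j, (∀ g, (c g).IsSmooth) ∧
        delta₁ (rows (-η) i (j + 1)) + delta₂ c = 0 :=
      ⟨b, hb, by rw [hbδ]; exact add_neg_cancel _⟩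
    have he : φ (i + 1) j = hex.choose := dif_pos hex
    rw [he]
    exact hex.choose_spec
  have hmain : ∀ i j : ℕ, i + j = k → (∀ g, (φ i j g).IsSmooth) ∧
      ∀ g, (delta₁ (φ i j) g).extD = 0 := by
    intro i
    induction i with
    | zero =>
      intro j hij
      obtain rfl : j = k := by omega
      have hs : ∀ g, (φ 0 j g).IsSmooth := fun g => by rw [h0]; exact hη.neg
      exact ⟨hs, extD_delta₁_of_base hinv hs fun g => by simp [h0, DForm.extD_neg, hηw]⟩
    | succ i ih =>
      intro j hij
      obtain ⟨hs, hd⟩ := ih (j + 1) (by omega)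
      obtain ⟨hs', hstep⟩ := hsucc i j hij hs hd
      exact ⟨hs', extD_delta₁_of_step hs' hstep⟩
  refine ⟨φ, fun i j hij => (hmain i j hij).1, fun g => by simp [h0, DForm.extD_neg, hηw],
    fun i j hij => ?_⟩
  obtain ⟨hs, hd⟩ := hmain i (j + 1) (by omega)
  exact (hsucc i j hij hs hd).2

end IsDescent

theorem pointCocycleDefined_of_conditions [ConnectedSpace M] {k : ℕ} {w : DForm I M (k + 1)}
    {x : M} (h : PointCocycleConditions G w x) : PointCocycleDefined G w x where
  conditions := h
  exists_descent := IsDescent.exists_isDescent h.vanishing h.invariant h.exact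
  isCocycle _ hφ := hφ.isRealCocycle h.invariant x
  point_independent _ hφ y := hφ.pointCocycle_eq h.invariant x y
  choice_independent _ _ hφ hψ := IsDescent.isRealCoboundary_sub h.vanishing hφ hψ x

end Descent

/-! ### Restriction to a subgroup -/

section Restriction

variable {E : Type*} [NormedAddCommGroup E] [NormedSpace ℝ E]
  {H : Type*} [TopologicalSpace H] {I : ModelWithCorners ℝ E H}
  {M : Type*} [TopologicalSpace M] [ChartedSpace H M]
  {G T : Subgroup (M ≃ₘ⟮I, I⟯ M)} {p q : ℕ}

theorem contractNth_inclusion (hT : T ≤ G) (j : Fin (p + 1)) (t : Fin (p + 1) → T) :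
    (fun l => Subgroup.inclusion hT (j.contractNth (· * ·) t l)) =
      j.contractNth (· * ·) fun l => Subgroup.inclusion hT (t l) :=
  Fin.comp_contractNth (· * ·) (· * ·) (map_mul (Subgroup.inclusion hT)) j t

theorem delta₁_restrict (hT : T ≤ G) (c : (Fin p → G) → DForm I M q) (t : Fin (p + 1) → T) :
    delta₁ (fun s : Fin p → T => c fun l => Subgroup.inclusion hT (s l)) t =
      delta₁ c fun l => Subgroup.inclusion hT (t l) := by
  unfold delta₁ cochainD
  simp only [contractNth_inclusion]
  rfl

theorem realD_restrict (hT : T ≤ G) (b : (Fin p → G) → ℝ) (t : Fin (p + 1) → T) :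
    realD (fun s : Fin p → T => b fun l => Subgroup.inclusion hT (s l)) t =
      realD b fun l => Subgroup.inclusion hT (t l) := by
  unfold realD cochainD
  simp only [contractNth_inclusion]
  rfl

theorem IsDescent.restrict (hT : T ≤ G) {k : ℕ} {w : DForm I M (k + 1)}
    {φ : ∀ i j : ℕ, (Fin i → G) → DForm I M j} (hφ : IsDescent G w φ) :
    IsDescent T w fun i j s => φ i j fun l => Subgroup.inclusion hT (s l) where
  smooth i j hij _ := hφ.smooth i j hij _
  base _ := hφ.base _
  step i j hij := by
    funext t
    rw [Pi.add_apply, delta₁_restrict]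
    exact congrFun (hφ.step i j hij) _

end Restriction

/-! ### Inserting vectors into an alternating form -/

section Splice

variable {V : Type*} {n i j : ℕ}

/-- The concatenation of two tuples. -/
def splice (h : i + j = n) (v : Fin i → V) (u : Fin j → V) (l : Fin n) : V :=
  if hl : (l : ℕ) < i then v ⟨l, hl⟩ else u ⟨l - i, by omega⟩

theorem splice_update_left [DecidableEq (Fin i)] (h : i + j = n) (v : Fin i → V) (u : Fin j → V) (a : Fin i) (x : V) :
    splice h (Function.update v a x) u =
      Function.update (splice h v u) ⟨a, by omega⟩ x := by
  funext l
  simp only [splice, Function.update_apply, Fin.ext_iff]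
  split_ifs <;> first | rfl | omega

theorem splice_update_right [DecidableEq (Fin j)] (h : i + j = n) (v : Fin i → V) (u : Fin j → V) (a : Fin j) (x : V) :
    splice h v (Function.update u a x) =
      Function.update (splice h v u) ⟨i + a, by omega⟩ x := by
  funext l
  simp only [splice, Function.update_apply, Fin.ext_iff]
  split_ifs <;> first | rfl | omega

theorem splice_init_cons (h : i + 1 + j = n) (h' : i + (j + 1) = n) (v : Fin (i + 1) → V)
    (u : Fin j → V) :
    splice h' (Fin.init v) (Fin.cons (v (Fin.last i)) u : Fin (j + 1) → V) = splice h v u := by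
  funext l
  unfold splice
  rcases lt_trichotomy (l : ℕ) i with hl | hl | hl
  · rw [dif_pos hl, dif_pos (by omega)]
    rfl
  · rw [dif_neg (by omega), dif_pos (by omega)]
    have : (⟨(l : ℕ) - i, by omega⟩ : Fin (j + 1)) = 0 := Fin.ext (by simp [hl])
    rw [this, Fin.cons_zero]
    congr 1
    exact Fin.ext hl.symm
  · rw [dif_neg (by omega), dif_neg (by omega)]
    have : (⟨(l : ℕ) - i, by omega⟩ : Fin (j + 1)) = Fin.succ ⟨(l : ℕ) - (i + 1), by omega⟩ :=
      Fin.ext (by simp; omega)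
    rw [this, Fin.cons_succ]

theorem splice_zero_right (v : Fin n → V) (u : Fin 0 → V) : splice (Nat.add_zero n) v u = v := by
  funext l
  simp [splice]

theorem splice_zero_left (v : Fin 0 → V) (u : Fin n → V) : splice (Nat.zero_add n) v u = u := by
  funext l
  simp [splice]

variable [NormedAddCommGroup V] [NormedSpace ℝ V]

/-- The alternating form with its first arguments fixed. -/
def insertVectors (a : V [⋀^Fin n]→L[ℝ] ℝ) (h : i + j = n) (v : Fin i → V) :
    V [⋀^Fin j]→L[ℝ] ℝ where
  toFun u := a (splice h v u)
  map_update_add' u l x y := by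
    simp only [splice_update_right, a.map_update_add]
  map_update_smul' u l x y := by
    simp only [splice_update_right, a.map_update_smul]
  cont := by
    refine a.cont.comp (continuous_pi fun l => ?_)
    unfold splice
    split_ifs
    · exact continuous_const
    · exact continuous_apply _
  map_eq_zero_of_eq' u b c hbc hne := by
    refine a.map_eq_zero_of_eq (splice h v u) (i := ⟨i + b, by omega⟩) (j := ⟨i + c, by omega⟩)
      ?_ fun he => hne (Fin.ext (by simpa using he))
    simpa [splice] using hbc

theorem insertVectors_apply (a : V [⋀^Fin n]→L[ℝ] ℝ) (h : i + j = n) (v : Fin i → V)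
    (u : Fin j → V) : insertVectors a h v u = a (splice h v u) := rfl

/-- The value of an alternating form, as a multilinear function of its first arguments. -/
def spliceMultilinear (a : V [⋀^Fin n]→L[ℝ] ℝ) (h : i + j = n) (u : Fin j → V) :
    MultilinearMap ℝ (fun _ : Fin i => V) ℝ where
  toFun v := a (splice h v u)
  map_update_add' v l x y := by
    simp only [splice_update_left, a.map_update_add]
  map_update_smul' v l x y := by
    simp only [splice_update_left, a.map_update_smul]

theorem spliceMultilinear_apply (a : V [⋀^Fin n]→L[ℝ] ℝ) (h : i + j = n) (v : Fin i → V)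
    (u : Fin j → V) : spliceMultilinear a h u v = a (splice h v u) := rfl

end Splice

/-! ### Forms on a vector space -/

section VectorForms

variable {V : Type*} [NormedAddCommGroup V] [NormedSpace ℝ V] {j : ℕ}

/-- The differential form on `V` given by a function with values in the alternating forms. -/
def vectorForm (a : V → V [⋀^Fin j]→L[ℝ] ℝ) : DForm 𝓘(ℝ, V) V j := a

theorem inChart_vectorForm (a : V → V [⋀^Fin j]→L[ℝ] ℝ) (x₀ : V) :
    (vectorForm a).inChart x₀ = a := by
  funext y
  have h : mfderiv 𝓘(ℝ, V) 𝓘(ℝ, V) (extChartAt 𝓘(ℝ, V) x₀).symm y =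
      ContinuousLinearMap.id ℝ V := by
    rw [extChartAt_model_space_eq_id]
    exact mfderiv_id
  rw [DForm.inChart_eq, h, extChartAt_model_space_eq_id]
  rfl

theorem isSmooth_vectorForm {a : V → V [⋀^Fin j]→L[ℝ] ℝ} (ha : ContDiff ℝ ∞ a) :
    (vectorForm a).IsSmooth := fun x₀ => by
  rw [inChart_vectorForm]
  exact ha.contDiffOn

theorem extD_vectorForm (a : V → V [⋀^Fin j]→L[ℝ] ℝ) :
    (vectorForm a).extD = vectorForm (extDeriv a) := by
  funext x
  rw [DForm.extD_eq, inChart_vectorForm, mfderiv_extChartAt_self, extChartAt_model_space_eq_id]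
  rfl

theorem extDeriv_clm (L : V →L[ℝ] V [⋀^Fin j]→L[ℝ] ℝ) (x : V) :
    extDeriv L x = .alternatizeUncurryFin L := by
  unfold extDeriv
  rw [ContinuousLinearMap.fderiv]

theorem pullback_add_vectorForm (v : V) (a : V → V [⋀^Fin j]→L[ℝ] ℝ) :
    DForm.pullback (I := 𝓘(ℝ, V)) (fun y => v + y) (vectorForm a) =
      vectorForm fun y => a (v + y) := by
  funext y
  unfold DForm.pullback
  have h : mfderiv 𝓘(ℝ, V) 𝓘(ℝ, V) (fun y => v + y) y = ContinuousLinearMap.id ℝ V := by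
    rw [mfderiv_eq_fderiv, fderiv_const_add]
    exact fderiv_id
  rw [h]
  rfl

end VectorForms

/-! ### The group of translations of `V × M` -/

section Translations

variable (V : Type*) [NormedAddCommGroup V] [NormedSpace ℝ V]
  {E : Type*} [NormedAddCommGroup E] [NormedSpace ℝ E]
  {H : Type*} [TopologicalSpace H] (I : ModelWithCorners ℝ E H)
  (M : Type*) [TopologicalSpace M] [ChartedSpace H M]

/-- The group of the translations along the first factor of `V × M`. -/
def translations : Subgroup ((V × M) ≃ₘ⟮𝓘(ℝ, V).prod I, 𝓘(ℝ, V).prod I⟯ (V × M)) where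
  carrier := {g | ∃ v : V, ∀ x, g x = (v + x.1, x.2)}
  one_mem' := ⟨0, fun x => by rw [zero_add]; rfl⟩
  mul_mem' := by
    rintro g h ⟨v, hv⟩ ⟨u, hu⟩
    exact ⟨v + u, fun x => by rw [diffeomorph_mul_apply, hu, hv, add_assoc]⟩
  inv_mem' := by
    rintro g ⟨v, hv⟩
    refine ⟨-v, fun x => g.injective ?_⟩
    change g (g⁻¹ x) = g (-v + x.1, x.2)
    rw [hv (-v + x.1, x.2), ← diffeomorph_mul_apply, mul_inv_cancel]
    change x = _
    simp

variable {V I M}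

/-- The translation by a vector. -/
def translation (v : V) : translations V I M :=
  ⟨{ toFun := fun x => (v + x.1, x.2)
     invFun := fun x => (-v + x.1, x.2)
     left_inv := fun x => by simp
     right_inv := fun x => by simp
     contMDiff_toFun := (contMDiff_const.add contMDiff_fst).prodMk contMDiff_snd
     contMDiff_invFun := (contMDiff_const.add contMDiff_fst).prodMk contMDiff_snd },
    v, fun _ => rfl⟩

/-- The vector of a translation. -/
def displacement (t : translations V I M) : V := t.2.choose

theorem translations_apply (t : translations V I M) (x : V × M) :
    (t : (V × M) ≃ₘ⟮𝓘(ℝ, V).prod I, 𝓘(ℝ, V).prod I⟯ (V × M)) x = (displacement t + x.1, x.2) :=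
  t.2.choose_spec x

variable [Nonempty M]

theorem displacement_mul (s t : translations V I M) :
    displacement (s * t) = displacement s + displacement t := by
  obtain ⟨m⟩ := ‹Nonempty M›
  have h := translations_apply (s * t) ((0 : V), m)
  rw [Subgroup.coe_mul, diffeomorph_mul_apply, translations_apply, translations_apply] at h
  simpa using (congrArg Prod.fst h).symm

theorem displacement_translation (v : V) :
    displacement (translation v : translations V I M) = v := by
  obtain ⟨m⟩ := ‹Nonempty M›
  have h := translations_apply (translation v : translations V I M) ((0 : V), m)
  change (v + 0, m) = _ at h
  simpa using (congrArg Prod.fst h).symm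

theorem translations_comm (s t : translations V I M) : s * t = t * s := by
  refine Subtype.ext (Diffeomorph.ext fun x => ?_)
  rw [translations_apply, translations_apply, displacement_mul, displacement_mul,
    add_comm (displacement s)]

end Translations

/-! ### Forms pulled back from the vector space -/

section FirstFactor

variable {V : Type*} [NormedAddCommGroup V] [NormedSpace ℝ V] [FiniteDimensional ℝ V]
  {E : Type*} [NormedAddCommGroup E] [NormedSpace ℝ E] [FiniteDimensional ℝ E]
  {H : Type*} [TopologicalSpace H] {I : ModelWithCorners ℝ E H} [I.Boundaryless]
  {M : Type*} [TopologicalSpace M] [ChartedSpace H M] [IsManifold I ∞ M] {i j k : ℕ}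

variable (I M) in
/-- The pull back to `V × M` of the form on `V` given by a function. -/
def fstForm (a : V → V [⋀^Fin j]→L[ℝ] ℝ) : DForm (𝓘(ℝ, V).prod I) (V × M) j :=
  DForm.pullback Prod.fst (vectorForm a)

theorem isSmooth_fstForm {a : V → V [⋀^Fin j]→L[ℝ] ℝ} (ha : ContDiff ℝ ∞ a) :
    (fstForm I M a).IsSmooth :=
  (isSmooth_vectorForm ha).pullback contMDiff_fst

theorem extD_fstForm {a : V → V [⋀^Fin j]→L[ℝ] ℝ} (ha : ContDiff ℝ ∞ a) :
    (fstForm I M a).extD = fstForm I M (extDeriv a) := by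
  rw [fstForm, DForm.extD_pullback (isSmooth_vectorForm ha) contMDiff_fst, extD_vectorForm]
  rfl

theorem pullback_fstForm (t : translations V I M) (a : V → V [⋀^Fin j]→L[ℝ] ℝ) :
    DForm.pullback (I := 𝓘(ℝ, V).prod I)
      (⇑(t : (V × M) ≃ₘ⟮𝓘(ℝ, V).prod I, 𝓘(ℝ, V).prod I⟯ (V × M))) (fstForm I M a) =
      fstForm I M fun y => a (displacement t + y) := by
  have hadd : MDifferentiable 𝓘(ℝ, V) 𝓘(ℝ, V) fun y : V => displacement t + y :=
    (differentiable_id.const_add _).mdifferentiable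
  have hfst : MDifferentiable (𝓘(ℝ, V).prod I) 𝓘(ℝ, V) (Prod.fst : V × M → V) :=
    mdifferentiable_fst
  unfold fstForm
  rw [← pullback_add_vectorForm, ← DForm.pullback_comp hfst (Diffeomorph.mdifferentiable _
    (by simp)), ← DForm.pullback_comp hadd hfst]
  congr 1
  funext x
  simp [translations_apply]

theorem pullback_snd_translation (t : translations V I M) (w : DForm I M j) :
    DForm.pullback (I := 𝓘(ℝ, V).prod I)
      (⇑(t : (V × M) ≃ₘ⟮𝓘(ℝ, V).prod I, 𝓘(ℝ, V).prod I⟯ (V × M)))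
      (DForm.pullback (I := 𝓘(ℝ, V).prod I) Prod.snd w) =
      DForm.pullback (I := 𝓘(ℝ, V).prod I) Prod.snd w := by
  have hsnd : MDifferentiable (𝓘(ℝ, V).prod I) I (Prod.snd : V × M → M) := mdifferentiable_snd
  rw [← DForm.pullback_comp hsnd (Diffeomorph.mdifferentiable _ (by simp))]
  congr 1
  funext x
  simp [translations_apply]

/-- The form on `V × M` obtained by inserting `i` vectors and the radial vector field of `V` into
an alternating form on `V`. -/
def radialForm (a : V [⋀^Fin (k + 1)]→L[ℝ] ℝ) (h : i + j = k) (t : Fin i → translations V I M) :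
    DForm (𝓘(ℝ, V).prod I) (V × M) j :=
  fstForm I M (insertVectors a (show i + (j + 1) = k + 1 by omega) fun l =>
    displacement (t l)).curryLeft

theorem isSmooth_radialForm (a : V [⋀^Fin (k + 1)]→L[ℝ] ℝ) (h : i + j = k)
    (t : Fin i → translations V I M) : (radialForm a h t).IsSmooth :=
  isSmooth_fstForm (ContinuousLinearMap.contDiff _)

theorem extD_radialForm (a : V [⋀^Fin (k + 1)]→L[ℝ] ℝ) (h : i + j = k)
    (t : Fin i → translations V I M) :
    (radialForm a h t).extD = ((j + 1 : ℕ) : ℝ) • fstForm I M fun _ =>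
      insertVectors a (show i + (j + 1) = k + 1 by omega) fun l => displacement (t l) := by
  rw [radialForm, extD_fstForm (ContinuousLinearMap.contDiff _)]
  have h : extDeriv (insertVectors a (show i + (j + 1) = k + 1 by omega) fun l =>
      displacement (t l)).curryLeft = fun _ => ((j + 1 : ℕ) : ℝ) • insertVectors a
      (show i + (j + 1) = k + 1 by omega) fun l => displacement (t l) := by
    funext y
    rw [extDeriv_clm, ContinuousAlternatingMap.alternatizeUncurryFin_curryLeft,
      Nat.cast_smul_eq_nsmul]
  rw [h]
  rfl

variable [Nonempty M]

theorem delta₁_radialForm (a : V [⋀^Fin (k + 1)]→L[ℝ] ℝ) (h : i + j = k)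
    (t : Fin (i + 1) → translations V I M) :
    delta₁ (radialForm a h) t = (-1 : ℤ) ^ (i + 1) • fstForm I M fun _ =>
      insertVectors a (show i + 1 + j = k + 1 by omega) fun l => displacement (t l) := by
  let L : (V → V [⋀^Fin j]→L[ℝ] ℝ) →+ DForm (𝓘(ℝ, V).prod I) (V × M) j :=
    AddMonoidHom.mk' (fstForm I M) fun _ _ => rfl
  have h' : i + (j + 1) = k + 1 := by omega
  let c : (Fin i → V) → V → V [⋀^Fin j]→L[ℝ] ℝ := fun v => (insertVectors a h' v).curryLeft
  set v : Fin (i + 1) → V := fun l => displacement (t l) with hv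
  have hlast : DForm.pullback (I := 𝓘(ℝ, V).prod I) (⇑(t (Fin.last i) :
      (V × M) ≃ₘ⟮𝓘(ℝ, V).prod I, 𝓘(ℝ, V).prod I⟯ (V × M))) (radialForm a h (Fin.init t)) =
      L fun y => c (Fin.init v) (v (Fin.last i) + y) := pullback_fstForm _ _
  have hmid : ∀ l : Fin i, radialForm a h (l.castSucc.contractNth (· * ·) t) =
      L (c (l.castSucc.contractNth (· + ·) v)) := by
    intro l
    have := Fin.comp_contractNth (· * ·) (· + ·) (displacement_mul (V := V) (I := I) (M := M))
      l.castSucc t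
    exact congrArg (fun u => L (c u)) this
  have htail : radialForm a h (Fin.tail t) = L (c (Fin.tail v)) := rfl
  change _ = (-1 : ℤ) ^ (i + 1) • L fun _ => insertVectors a _ v
  unfold delta₁ cochainD
  simp only [hmid, hlast, htail, ← map_zsmul, ← map_sum, ← map_add]
  congr 1
  funext y
  ext u
  have hid := (spliceMultilinear a h' (Fin.cons y u)).cocycle_identity v
  simp only [spliceMultilinear_apply] at hid
  have hadd : a (splice h' (Fin.init v) (Fin.cons (v (Fin.last i) + y) u)) =
      a (splice (show i + 1 + j = k + 1 by omega) v u) +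
        a (splice h' (Fin.init v) (Fin.cons y u)) := by
    rw [← splice_init_cons (show i + 1 + j = k + 1 by omega) h' v u]
    exact congrArg (fun b : V [⋀^Fin j]→L[ℝ] ℝ => b u)
      ((insertVectors a h' (Fin.init v)).curryLeft.map_add (v (Fin.last i)) y)
  let ev : (V → V [⋀^Fin j]→L[ℝ] ℝ) →+ ℝ := AddMonoidHom.mk' (fun b => b y u) fun _ _ => rfl
  have hev : ∀ (s : Fin i → V) (z : V), c s z u = a (splice h' s (Fin.cons z u)) :=
    fun _ _ => rfl
  change ev (c (Fin.tail v) + ∑ l : Fin i, (-1 : ℤ) ^ ((l : ℕ) + 1) •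
    c (l.castSucc.contractNth (· + ·) v) + (-1 : ℤ) ^ (i + 1) •
    fun y => c (Fin.init v) (v (Fin.last i) + y)) =
    ev ((-1 : ℤ) ^ (i + 1) • fun _ => insertVectors a (show i + 1 + j = k + 1 by omega) v)
  rw [map_add, map_add, map_sum]
  simp only [map_zsmul]
  change c (Fin.tail v) y u + ∑ l : Fin i, (-1 : ℤ) ^ ((l : ℕ) + 1) •
    c (l.castSucc.contractNth (· + ·) v) y u + (-1 : ℤ) ^ (i + 1) •
    c (Fin.init v) (v (Fin.last i) + y) u = (-1 : ℤ) ^ (i + 1) • a (splice _ v u)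
  simp only [hev]
  rw [hadd, smul_add, add_left_comm, hid, add_zero]

end FirstFactor

/-! ### Sums of descents -/

section DescentSum

variable {E : Type*} [NormedAddCommGroup E] [NormedSpace ℝ E] [FiniteDimensional ℝ E]
  {H : Type*} [TopologicalSpace H] {I : ModelWithCorners ℝ E H} [I.Boundaryless]
  {M : Type*} [TopologicalSpace M] [ChartedSpace H M] [IsManifold I ∞ M]
  {G : Subgroup (M ≃ₘ⟮I, I⟯ M)} {p q k : ℕ}

theorem delta₁_add (c c' : (Fin p → G) → DForm I M q) :
    delta₁ (c + c') = delta₁ c + delta₁ c' :=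
  cochainD_add (fun _ _ _ => rfl) c c'

theorem delta₁_zero : delta₁ (0 : (Fin p → G) → DForm I M q) = 0 := by
  simpa using delta₁_zsmul 0 (0 : (Fin p → G) → DForm I M q)

theorem delta₁_smul (r : ℝ) (c : (Fin p → G) → DForm I M q) :
    delta₁ (r • c) = r • delta₁ c := by
  funext g
  change r • c (Fin.tail g) + ∑ i : Fin p, (-1 : ℤ) ^ ((i : ℕ) + 1) •
    r • c (i.castSucc.contractNth (· * ·) g) + (-1 : ℤ) ^ (p + 1) •
    r • DForm.pullback _ (c (Fin.init g)) = r • (_ + _ + _)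
  simp only [smul_add, Finset.smul_sum, smul_comm r (_ : ℤ)]

theorem IsDescent.add {w w' : DForm I M (k + 1)} {φ ψ : ∀ i j : ℕ, (Fin i → G) → DForm I M j}
    (hφ : IsDescent G w φ) (hψ : IsDescent G w' ψ) : IsDescent G (w + w') (φ + ψ) where
  smooth i j hij g := (hφ.smooth i j hij g).add (hψ.smooth i j hij g)
  base g := by
    change _ = -(φ 0 k g + ψ 0 k g).extD
    rw [DForm.extD_add (hφ.smooth 0 k (by omega) g) (hψ.smooth 0 k (by omega) g), neg_add,
      ← hφ.base g, ← hψ.base g]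
  step i j hij := by
    have h : delta₂ ((φ + ψ) (i + 1) j) = delta₂ (φ (i + 1) j) + delta₂ (ψ (i + 1) j) := by
      funext g
      change _ • (φ (i + 1) j g + ψ (i + 1) j g).extD = _
      rw [DForm.extD_add (hφ.smooth _ _ hij g) (hψ.smooth _ _ hij g), smul_add]
      rfl
    rw [h, Pi.add_apply, Pi.add_apply, delta₁_add, add_add_add_comm, hφ.step i j hij,
      hψ.step i j hij, add_zero]

/-- The cochains given by an invariant form in row zero. -/
def invariantRow (η : DForm I M k) : ∀ i j : ℕ, (Fin i → G) → DForm I M j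
  | 0 => Function.update (fun _ _ => 0) k fun _ => η
  | _ + 1 => 0

theorem delta₁_invariantRow {η : DForm I M k} (hη : ∀ g ∈ G, DForm.pullback (I := I) (⇑g) η = η)
    (i j : ℕ) : delta₁ (invariantRow (G := G) η i j) = 0 := by
  cases i with
  | zero =>
    by_cases hj : j = k
    · subst hj
      simpa [invariantRow] using delta₁_const hη
    · rw [invariantRow, Function.update_of_ne hj]
      exact delta₁_zero
  | succ i => exact delta₁_zero

theorem isDescent_invariantRow {η : DForm I M k} (hs : η.IsSmooth)
    (hη : ∀ g ∈ G, DForm.pullback (I := I) (⇑g) η = η) :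
    IsDescent G (-η.extD) (invariantRow η) where
  smooth i j hij g := by
    cases i with
    | zero =>
      obtain rfl : j = k := by omega
      simpa [invariantRow] using hs
    | succ i => exact DForm.isSmooth_zero
  base g := by simp [invariantRow]
  step i j hij := by
    rw [delta₁_invariantRow hη, zero_add]
    funext g
    change _ • DForm.extD 0 = _
    rw [DForm.extD_zero, smul_zero]
    rfl

end DescentSum

/-! ### The descent over the group of translations -/

section RadialDescent

variable {V : Type*} [NormedAddCommGroup V] [NormedSpace ℝ V] [FiniteDimensional ℝ V]
  {E : Type*} [NormedAddCommGroup E] [NormedSpace ℝ E] [FiniteDimensional ℝ E]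
  {H : Type*} [TopologicalSpace H] {I : ModelWithCorners ℝ E H} [I.Boundaryless]
  {M : Type*} [TopologicalSpace M] [ChartedSpace H M] [IsManifold I ∞ M] {i j k : ℕ}

/-- The coefficients of the radial forms in the descent of a constant form. -/
def radialCoeff (k i j : ℕ) : ℝ := (-1) ^ (i + 1) * (j.factorial : ℝ) / ((k + 1).factorial : ℝ)

theorem radialCoeff_zero (k : ℕ) : radialCoeff k 0 k * ((k + 1 : ℕ) : ℝ) = -1 := by
  unfold radialCoeff
  have : ((k + 1 : ℕ) : ℝ) ≠ 0 := by positivity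
  have : (k.factorial : ℝ) ≠ 0 := by positivity
  rw [Nat.factorial_succ]
  push_cast
  field_simp

theorem radialCoeff_succ (k i j : ℕ) :
    radialCoeff k i (j + 1) + radialCoeff k (i + 1) j * ((j + 1 : ℕ) : ℝ) = 0 := by
  unfold radialCoeff
  rw [Nat.factorial_succ j]
  push_cast
  ring

theorem insertVectors_zero (a : V [⋀^Fin k]→L[ℝ] ℝ) (h : 0 + k = k) (v : Fin 0 → V) :
    insertVectors a h v = a := by
  ext u
  rw [insertVectors_apply, splice_zero_left]

/-- The cochains of the group of translations made of radial forms. -/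
def radialDescent (a : V [⋀^Fin (k + 1)]→L[ℝ] ℝ) :
    ∀ i j : ℕ, (Fin i → translations V I M) → DForm (𝓘(ℝ, V).prod I) (V × M) j :=
  fun i j t => if h : i + j = k then radialCoeff k i j • radialForm a h t else 0

theorem radialDescent_eq (a : V [⋀^Fin (k + 1)]→L[ℝ] ℝ) (h : i + j = k) :
    (radialDescent a i j : (Fin i → translations V I M) → _) =
      radialCoeff k i j • radialForm a h :=
  funext fun _ => dif_pos h

variable [Nonempty M]

theorem isDescent_radialDescent (a : V [⋀^Fin (k + 1)]→L[ℝ] ℝ) :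
    IsDescent (translations V I M) (fstForm I M fun _ => a) (radialDescent a) where
  smooth i j h t := by
    rw [radialDescent_eq a h]
    exact (isSmooth_radialForm a h t).smul _
  base t := by
    rw [radialDescent_eq a (Nat.zero_add k), Pi.smul_apply, DForm.extD_smul, extD_radialForm,
      smul_smul, radialCoeff_zero]
    simp only [insertVectors_zero]
    exact neg_eq_iff_eq_neg.mp (neg_one_smul ℝ (fstForm I M fun _ => a)).symm
  step i j h := by
    funext t
    change delta₁ _ t + (-1 : ℤ) ^ (i + 1) • DForm.extD _ = 0
    rw [radialDescent_eq a h, radialDescent_eq a (show i + (j + 1) = k by omega), delta₁_smul,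
      Pi.smul_apply, Pi.smul_apply, DForm.extD_smul, extD_radialForm, delta₁_radialForm, smul_smul,
      smul_comm (radialCoeff k i (j + 1)), ← smul_add, ← add_smul, radialCoeff_succ, zero_smul,
      smul_zero]

theorem pointCocycle_radialDescent (a : V [⋀^Fin (k + 1)]→L[ℝ] ℝ) (x : V × M)
    (t : Fin (k + 1) → translations V I M) :
    pointCocycle (translations V I M) k (radialDescent a) x t =
      ((k + 1).factorial : ℝ)⁻¹ * a fun l => displacement (t l) := by
  unfold pointCocycle
  rw [radialDescent_eq a (Nat.add_zero k), delta₁_smul, Pi.smul_apply, delta₁_radialForm]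
  rw [← Int.cast_smul_eq_zsmul ℝ, smul_smul]
  refine (congrArg (fun v => _ * a v) (splice_zero_right (fun l => displacement (t l)) _)).trans ?_
  congr 1
  unfold radialCoeff
  push_cast
  rw [mul_comm, mul_div_assoc', ← mul_assoc, ← mul_pow]
  simp

end RadialDescent

/-! ### The sum of a constant form and an exact form on a product -/

section SumForm

variable {V : Type*} [NormedAddCommGroup V] [NormedSpace ℝ V] [FiniteDimensional ℝ V]
  {E : Type*} [NormedAddCommGroup E] [NormedSpace ℝ E] [FiniteDimensional ℝ E]
  {H : Type*} [TopologicalSpace H] {I : ModelWithCorners ℝ E H} [I.Boundaryless]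
  {M : Type*} [TopologicalSpace M] [ChartedSpace H M] [IsManifold I ∞ M] {k : ℕ}

theorem sumForm_eq (ω₀ : V [⋀^Fin k]→L[ℝ] ℝ) (ωM : DForm I M k) :
    sumForm ω₀ ωM = fstForm I M (fun _ => ω₀) +
      DForm.pullback (I := 𝓘(ℝ, V).prod I) Prod.snd ωM := rfl

theorem translations_le_diffPreserving (ω₀ : V [⋀^Fin k]→L[ℝ] ℝ) (ωM : DForm I M k) :
    translations V I M ≤ diffPreserving (sumForm ω₀ ωM) := by
  intro t ht
  change DForm.pullback (I := 𝓘(ℝ, V).prod I) t _ = _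
  rw [sumForm_eq, DForm.pullback_add]
  exact congrArg₂ (· + ·) (pullback_fstForm ⟨t, ht⟩ _) (pullback_snd_translation ⟨t, ht⟩ _)

theorem isSmooth_sumForm (ω₀ : V [⋀^Fin k]→L[ℝ] ℝ) {ωM : DForm I M k} (hs : ωM.IsSmooth) :
    (sumForm ω₀ ωM).IsSmooth :=
  (isSmooth_fstForm contDiff_const).add (hs.pullback contMDiff_snd)

theorem isExact_sumForm [Nonempty M] (ω₀ : V [⋀^Fin (k + 1)]→L[ℝ] ℝ) {ωM : DForm I M (k + 1)}
    (he : ωM.IsExact) : (sumForm ω₀ ωM).IsExact := by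
  obtain ⟨η, hη, rfl⟩ := he
  have hd := isDescent_radialDescent (I := I) (M := M) ω₀
  have hs := hd.smooth 0 k (Nat.zero_add k) ![]
  have hp : ContMDiff (𝓘(ℝ, V).prod I) I ∞ (Prod.snd : V × M → M) := contMDiff_snd
  refine ⟨-radialDescent ω₀ 0 k ![] + DForm.pullback (I := 𝓘(ℝ, V).prod I) Prod.snd η,
    hs.neg.add (hη.pullback hp), ?_⟩
  rw [DForm.extD_add hs.neg (hη.pullback hp), DForm.extD_neg, ← hd.base ![],
    DForm.extD_pullback hη hp, sumForm_eq]

variable [ConnectedSpace M]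

include I in
variable (I) in
theorem pathConnectedSpace_prod : PathConnectedSpace (V × M) := by
  have : LocallyPathConnectedSpace H := I.toHomeomorph.isOpenEmbedding.locallyPathConnectedSpace
  have : LocallyPathConnectedSpace M := ChartedSpace.locallyPathConnectedSpace H M
  have : PathConnectedSpace M := pathConnectedSpace_iff_connectedSpace.mpr inferInstance
  infer_instance

theorem pointCocycleDefined_sumForm (hv : ∀ q, 1 ≤ q → q ≤ k → DeRhamVanishes I M q)
    (ω₀ : V [⋀^Fin (k + 1)]→L[ℝ] ℝ) {ωM : DForm I M (k + 1)} (hs : ωM.IsSmooth)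
    (he : ωM.IsExact) (x : V × M) :
    PointCocycleDefined (diffPreserving (sumForm ω₀ ωM)) (sumForm ω₀ ωM) x := by
  refine pointCocycleDefined_of_conditions
    ⟨isSmooth_sumForm ω₀ hs, isExact_sumForm ω₀ he, fun g hg => hg, fun q hq hqk => ?_,
      DForm.not_deRhamVanishes_zero, fun g _ => ?_⟩
  · obtain ⟨q, rfl⟩ : ∃ r, q = r + 1 := ⟨q - 1, by omega⟩
    exact deRhamVanishes_prod (hv _ hq hqk)
  · have := pathConnectedSpace_prod (V := V) (M := M) I
    exact PathConnectedSpace.joined _ _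

theorem exists_isDescent_translations (ω₀ : V [⋀^Fin (k + 1)]→L[ℝ] ℝ) {ωM : DForm I M (k + 1)}
    (he : ωM.IsExact) (x : V × M) :
    ∃ ψ, IsDescent (translations V I M) (sumForm ω₀ ωM) ψ ∧ ∀ t,
      pointCocycle (translations V I M) k ψ x t =
        ((k + 1).factorial : ℝ)⁻¹ * ω₀ fun l => displacement (t l) := by
  obtain ⟨η, hη, rfl⟩ := he
  have hp : ContMDiff (𝓘(ℝ, V).prod I) I ∞ (Prod.snd : V × M → M) := contMDiff_snd
  let η' := -DForm.pullback (I := 𝓘(ℝ, V).prod I) (Prod.snd : V × M → M) η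
  have hη' : ∀ g ∈ translations V I M, DForm.pullback (I := 𝓘(ℝ, V).prod I) (⇑g) η' = η' :=
    fun g hg => congrArg Neg.neg (pullback_snd_translation ⟨g, hg⟩ η)
  refine ⟨radialDescent ω₀ + invariantRow η', ?_, fun t => ?_⟩
  · have h := (isDescent_radialDescent (I := I) (M := M) ω₀).add
      (isDescent_invariantRow (hη.pullback hp).neg hη')
    rwa [DForm.extD_neg, neg_neg, DForm.extD_pullback hη hp, ← sumForm_eq] at h
  · rw [← pointCocycle_radialDescent ω₀ x t]
    unfold pointCocycle
    rw [Pi.add_apply, Pi.add_apply, delta₁_add, delta₁_invariantRow hη', add_zero]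

theorem pointCocycleNontrivial_sumForm (hv : ∀ q, 1 ≤ q → q ≤ k → DeRhamVanishes I M q)
    {ω₀ : V [⋀^Fin (k + 1)]→L[ℝ] ℝ} (h₀ : ω₀ ≠ 0) {ωM : DForm I M (k + 1)}
    (he : ωM.IsExact) (x : V × M) :
    PointCocycleNontrivial (diffPreserving (sumForm ω₀ ωM)) (sumForm ω₀ ωM) x := by
  rintro φ hφ ⟨b, hb⟩
  have hT := translations_le_diffPreserving ω₀ ωM
  obtain ⟨ψ, hψ, hψx⟩ := exists_isDescent_translations ω₀ he x
  have hvp : ∀ q, 1 ≤ q → q ≤ k → DeRhamVanishes (𝓘(ℝ, V).prod I) (V × M) q := fun q hq hqk => by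
    obtain ⟨q, rfl⟩ : ∃ r, q = r + 1 := ⟨q - 1, by omega⟩
    exact deRhamVanishes_prod (hv _ hq hqk)
  obtain ⟨c, hc⟩ := IsDescent.isRealCoboundary_sub hvp (hφ.restrict hT) hψ x
  have hbc : ∀ t, realD ((fun s => b fun l => Subgroup.inclusion hT (s l)) - c) t =
      ((k + 1).factorial : ℝ)⁻¹ * ω₀ fun l => displacement (t l) := by
    intro t
    have hsub : ∀ f f' : (Fin k → translations V I M) → ℝ,
        realD (f - f') = realD f - realD f' := cochainD_sub fun _ _ _ => rfl
    have hφt : pointCocycle (translations V I M) k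
        (fun i j s => φ i j fun l => Subgroup.inclusion hT (s l)) x t =
        pointCocycle _ k φ x fun l => Subgroup.inclusion hT (t l) := by
      unfold pointCocycle
      rw [delta₁_restrict]
    rw [hsub, Pi.sub_apply, realD_restrict, hc, hb, Pi.sub_apply, hφt, sub_sub_cancel, hψx]
  refine h₀ (ContinuousAlternatingMap.ext fun v => ?_)
  have hsum := sum_sign_realD_eq_zero translations_comm
    ((fun s => b fun l => Subgroup.inclusion hT (s l)) - c)
    fun l => (translation (v l) : translations V I M)
  have hterm : ∀ σ : Equiv.Perm (Fin (k + 1)), ((Equiv.Perm.sign σ : ℤˣ) : ℤ) •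
      (((k + 1).factorial : ℝ)⁻¹ * ω₀ fun l => v (σ l)) = ((k + 1).factorial : ℝ)⁻¹ * ω₀ v := by
    intro σ
    have h : (ω₀ fun l => v (σ l)) = Equiv.Perm.sign σ • ω₀ v := ω₀.toAlternatingMap.map_perm v σ
    rw [h, Units.smul_def, mul_smul_comm, smul_smul]
    rcases Int.units_eq_one_or (Equiv.Perm.sign σ) with h | h <;> simp [h]
  simp only [hbc, displacement_translation, hterm] at hsum
  rw [Finset.sum_const, Finset.card_univ, Fintype.card_perm, Fintype.card_fin, nsmul_eq_mul,
    mul_inv_cancel_left₀ (by positivity)] at hsum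
  exact hsum

end SumForm

/-! ### Wedge products of linear forms -/

section DetForm

variable {V : Type*} [AddCommGroup V] [Module ℝ V]

/-- The wedge product of a family of linear forms. -/
def detForm {ι : Type*} [Fintype ι] [DecidableEq ι] (f : ι → V →ₗ[ℝ] ℝ) : V [⋀^ι]→ₗ[ℝ] ℝ :=
  MultilinearMap.alternatization ((MultilinearMap.mkPiAlgebra ℝ ι ℝ).compLinearMap f)

theorem detForm_apply {ι : Type*} [Fintype ι] [DecidableEq ι] (f : ι → V →ₗ[ℝ] ℝ) (v : ι → V) :
    detForm f v = (Matrix.of fun a b => f a (v b)).det := by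
  rw [detForm, MultilinearMap.alternatization_apply, ← Matrix.det_transpose, Matrix.det_apply]
  rfl

theorem altWedge_detForm {k l : ℕ} (f : Fin k → V →ₗ[ℝ] ℝ) (g : Fin l → V →ₗ[ℝ] ℝ) :
    altWedge (detForm f) (detForm g) =
      detForm fun a => Sum.elim f g (finSumFinEquiv.symm a) := by
  have h : (LinearMap.mul' ℝ ℝ).compAlternatingMap ((detForm f).domCoprod (detForm g)) =
      detForm (Sum.elim f g) := by
    rw [detForm, detForm, detForm, ← MultilinearMap.domCoprod_alternization,
      ← LinearMap.compMultilinearMap_alternatization]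
    congr 1
    ext v
    simp [MultilinearMap.domCoprod]
  rw [altWedge, h]
  ext v
  rw [AlternatingMap.domDomCongr_apply, detForm_apply, detForm_apply,
    ← Matrix.det_submatrix_equiv_self finSumFinEquiv]
  congr 1
  ext a b
  simp

theorem coordForm_eq_detForm {N : ℕ} (i : Fin N) :
    coordForm i = detForm fun _ : Fin 1 =>
      (EuclideanSpace.proj i : EuclideanSpace ℝ (Fin N) →L[ℝ] ℝ).toLinearMap := by
  ext v
  rw [detForm_apply, Matrix.det_unique]
  rfl

theorem altWedge_sum {k l : ℕ} {ι κ : Type*} (s : Finset ι) (t : Finset κ)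
    (a : ι → V [⋀^Fin k]→ₗ[ℝ] ℝ) (b : κ → V [⋀^Fin l]→ₗ[ℝ] ℝ) :
    altWedge (∑ i ∈ s, a i) (∑ j ∈ t, b j) = ∑ i ∈ s, ∑ j ∈ t, altWedge (a i) (b j) := by
  let W : V [⋀^Fin k]→ₗ[ℝ] ℝ → V [⋀^Fin l]→ₗ[ℝ] ℝ → V [⋀^Fin (k + l)]→ₗ[ℝ] ℝ := altWedge
  have hl : ∀ a a' b, W (a + a') b = W a b + W a' b := fun a a' b => by
    simp only [W, altWedge, ← AlternatingMap.domCoprod'_apply, TensorProduct.add_tmul, map_add]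
    ext v
    exact map_add (LinearMap.mul' ℝ ℝ) _ _
  have hr : ∀ a b b', W a (b + b') = W a b + W a b' := fun a b b' => by
    simp only [W, altWedge, ← AlternatingMap.domCoprod'_apply, TensorProduct.tmul_add, map_add]
    ext v
    exact map_add (LinearMap.mul' ℝ ℝ) _ _
  let B : V [⋀^Fin k]→ₗ[ℝ] ℝ →+ V [⋀^Fin l]→ₗ[ℝ] ℝ →+ V [⋀^Fin (k + l)]→ₗ[ℝ] ℝ :=
    AddMonoidHom.mk' (fun a => AddMonoidHom.mk' (W a) (hr a)) fun a a' =>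
      AddMonoidHom.ext fun b => hl a a' b
  change B (∑ i ∈ s, a i) (∑ j ∈ t, b j) = ∑ i ∈ s, ∑ j ∈ t, B (a i) (b j)
  simp only [map_sum, AddMonoidHom.finsetSum_apply]
  exact Finset.sum_comm

end DetForm

/-! ### Powers of the symplectic form -/

section SymplecticPower

/-- The coordinate function `x_c` or `x_{n + c}` on `ℝ^{2n}`, according to the parity of `l`. -/
def darbouxCoord {n : ℕ} (c : Fin n) (l : ℕ) : Fin (2 * n) :=
  if l % 2 = 0 then ⟨c, by omega⟩ else ⟨n + c, by omega⟩

theorem darbouxCoord_eq_iff {n : ℕ} (c d : Fin n) (l r : ℕ) :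
    darbouxCoord c l = darbouxCoord d r ↔ c = d ∧ l % 2 = r % 2 := by
  unfold darbouxCoord
  split_ifs <;> simp only [Fin.ext_iff] <;> omega

/-- The coordinates `x_{c 0}, x_{n + c 0}, x_{c 1}, x_{n + c 1}, …`. -/
def darbouxForms {n m : ℕ} (c : Fin m → Fin n) (l : Fin (2 * m)) :
    EuclideanSpace ℝ (Fin (2 * n)) →ₗ[ℝ] ℝ :=
  (EuclideanSpace.proj (darbouxCoord (c ⟨l / 2, by omega⟩) l) :
    EuclideanSpace ℝ (Fin (2 * n)) →L[ℝ] ℝ).toLinearMap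

theorem darbouxForms_eq {n m : ℕ} {c : Fin m → Fin n} {l : Fin (2 * m)} {d : Fin n} {r : ℕ}
    (hd : c ⟨l / 2, by omega⟩ = d) (hr : (l : ℕ) % 2 = r % 2) :
    darbouxForms c l = (EuclideanSpace.proj (darbouxCoord d r) :
      EuclideanSpace ℝ (Fin (2 * n)) →L[ℝ] ℝ).toLinearMap := by
  rw [darbouxForms, (darbouxCoord_eq_iff _ d l r).mpr ⟨hd, hr⟩]

theorem stdSymplectic_eq (n : ℕ) :
    stdSymplectic n = ∑ d : Fin n, detForm fun l : Fin 2 =>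
      (EuclideanSpace.proj (darbouxCoord d l) :
        EuclideanSpace ℝ (Fin (2 * n)) →L[ℝ] ℝ).toLinearMap := by
  refine Finset.sum_congr rfl fun d _ => ?_
  rw [coordForm_eq_detForm, coordForm_eq_detForm, altWedge_detForm]
  congr 1
  funext l
  fin_cases l <;> rfl

theorem altWedgePow_stdSymplectic (n m : ℕ) :
    altWedgePow (stdSymplectic n) m = ∑ c : Fin m → Fin n, detForm (darbouxForms c) := by
  induction m with
  | zero =>
    have : IsEmpty (Fin (2 * 0)) := inferInstanceAs (IsEmpty (Fin 0))
    rw [Fintype.sum_unique]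
    ext v
    rw [detForm_apply, Matrix.det_isEmpty]
    rfl
  | succ m ih =>
    rw [altWedgePow, ih, stdSymplectic_eq, altWedge_sum, Finset.sum_comm,
      ← Fintype.sum_prod_type', ← (Fin.snocEquiv fun _ => Fin n).sum_comp]
    refine Finset.sum_congr rfl fun p _ => ?_
    rw [altWedge_detForm]
    congr 1
    funext l
    refine Fin.addCases (m := 2 * m) (n := 2) (fun l => ?_) (fun l => ?_) l
    · have hl : (l : ℕ) / 2 < m := by omega
      refine (congrArg (Sum.elim _ _) (finSumFinEquiv_symm_apply_castAdd l)).trans ?_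
      exact (darbouxForms_eq (m := m + 1) (l := Fin.castAdd 2 l)
        (Fin.snoc_castSucc (α := fun _ => Fin n) p.1 p.2 ⟨l / 2, hl⟩) rfl).symm
    · refine (congrArg (Sum.elim _ _) (finSumFinEquiv_symm_apply_natAdd l)).trans ?_
      have hl : ((Fin.natAdd (2 * m) l : Fin (2 * m + 2)) : ℕ) = 2 * m + l := rfl
      refine (darbouxForms_eq (m := m + 1) (l := Fin.natAdd (2 * m) l) (d := p.1) ?_ ?_).symm
      · refine (congrArg _ ?_).trans (Fin.snoc_last (α := fun _ => Fin n) p.1 p.2)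
        exact Fin.ext (by change (2 * m + (l : ℕ)) / 2 = m; omega)
      · rw [hl]; omega

/-- The standard basis of `ℝ^{2n}` ordered as `e_0, e_n, e_1, e_{n + 1}, …`. -/
def darbouxVectors {n m : ℕ} (h : m ≤ n) (l : Fin (2 * m)) : EuclideanSpace ℝ (Fin (2 * n)) :=
  EuclideanSpace.single (darbouxCoord (Fin.castLE h ⟨l / 2, by omega⟩) l) 1

theorem detForm_darbouxForms {n m : ℕ} (h : m ≤ n) (c : Fin m → Fin n) :
    detForm (darbouxForms c) (darbouxVectors h) =
      (Matrix.of fun a b : Fin m => if c a = Fin.castLE h b then (1 : ℝ) else 0).det ^ 2 := by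
  let e : Fin m × Fin 2 ≃ Fin (2 * m) := finProdFinEquiv.trans (finCongr (mul_comm m 2))
  have hK := Matrix.det_kronecker
    (Matrix.of fun a b : Fin m => if c a = Fin.castLE h b then (1 : ℝ) else 0)
    (1 : Matrix (Fin 2) (Fin 2) ℝ)
  rw [Matrix.det_one, one_pow, mul_one, Fintype.card_fin] at hK
  rw [detForm_apply, ← hK, ← Matrix.det_submatrix_equiv_self e]
  congr 1
  ext ⟨a, r⟩ ⟨b, s⟩
  have hdiv : ∀ (a : Fin m) (r : Fin 2), (⟨(e (a, r) : ℕ) / 2, by omega⟩ : Fin m) = a :=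
    fun a r => Fin.ext (by simp [e]; omega)
  have hmod : ∀ (a : Fin m) (r : Fin 2), (e (a, r) : ℕ) % 2 = r :=
    fun a r => by simp [e]; omega
  have hrs : ((r : ℕ) = s) ↔ r = s := Fin.ext_iff.symm
  have h2 := darbouxCoord_eq_iff (c a) (Fin.castLE h b) (e (a, r)) (e (b, s))
  rw [hmod, hmod, hrs] at h2
  have hv : darbouxVectors h (e (b, s)) =
      EuclideanSpace.single (darbouxCoord (Fin.castLE h b) (e (b, s))) 1 := by
    rw [darbouxVectors, hdiv]
  simp [darbouxForms, hv, Matrix.one_apply, hdiv, h2, ← ite_and, and_comm]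

theorem stdSymplecticPow_ne_zero {n j : ℕ} (h : j + 1 ≤ n) : stdSymplecticPow n j ≠ 0 := by
  intro h₀
  have hv : altWedgePow (stdSymplectic n) (j + 1) (darbouxVectors h) = 0 :=
    congrArg (fun a : EuclideanSpace ℝ (Fin (2 * n)) [⋀^Fin (2 * j + 1 + 1)]→L[ℝ] ℝ =>
      a (darbouxVectors h)) h₀
  let ev : EuclideanSpace ℝ (Fin (2 * n)) [⋀^Fin (2 * (j + 1))]→ₗ[ℝ] ℝ →+ ℝ :=
    AddMonoidHom.mk' (fun a => a (darbouxVectors h)) fun _ _ => rfl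
  change ev (altWedgePow (stdSymplectic n) (j + 1)) = 0 at hv
  rw [altWedgePow_stdSymplectic, map_sum] at hv
  simp only [ev, AddMonoidHom.mk'_apply, detForm_darbouxForms] at hv
  have h1 := (Finset.sum_eq_zero_iff_of_nonneg fun c _ => sq_nonneg _).mp hv (Fin.castLE h)
    (Finset.mem_univ _)
  have hone : (Matrix.of fun a b : Fin (j + 1) =>
      if Fin.castLE h a = Fin.castLE h b then (1 : ℝ) else 0) = 1 := by
    ext a b
    simp [Matrix.one_apply]
  rw [hone, Matrix.det_one] at h1
  norm_num at h1

end SymplecticPower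

end

theorem mainTheorem3
    {E : Type*} [NormedAddCommGroup E] [NormedSpace ℝ E] [FiniteDimensional ℝ E]
    {M : Type*} [TopologicalSpace M] [ChartedSpace E M] [IsManifold 𝓘(ℝ, E) ∞ M]
    [ConnectedSpace M] :
    (∀ (n k : ℕ) (ω₀ : EuclideanSpace ℝ (Fin n) [⋀^Fin (k + 1)]→L[ℝ] ℝ)
      (ωM : DForm 𝓘(ℝ, E) M (k + 1)),
      (∀ q, 1 ≤ q → q ≤ k → DeRhamVanishes 𝓘(ℝ, E) M q) →
      ω₀ ≠ 0 → ωM.IsSmooth → ωM.IsExact →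
      ∀ x : EuclideanSpace ℝ (Fin n) × M,
        PointCocycleDefined (diffPreserving (sumForm ω₀ ωM)) (sumForm ω₀ ωM) x ∧
        PointCocycleNontrivial (diffPreserving (sumForm ω₀ ωM)) (sumForm ω₀ ωM) x) ∧
    (∀ (n j : ℕ) (ωM : DForm 𝓘(ℝ, E) M (2 * j + 1 + 1)),
      j + 1 ≤ n →
      (∀ q, 1 ≤ q → q ≤ 2 * j + 1 → DeRhamVanishes 𝓘(ℝ, E) M q) →
      ωM.IsSmooth → ωM.IsExact →
      ∀ x : EuclideanSpace ℝ (Fin (2 * n)) × M,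
        PointCocycleDefined (diffPreserving (sumForm (stdSymplecticPow n j) ωM))
          (sumForm (stdSymplecticPow n j) ωM) x ∧
        PointCocycleNontrivial (diffPreserving (sumForm (stdSymplecticPow n j) ωM))
          (sumForm (stdSymplecticPow n j) ωM) x) := by
  refine ⟨fun n k ω₀ ωM hv h₀ hs he x => ⟨pointCocycleDefined_sumForm hv ω₀ hs he x,
    pointCocycleNontrivial_sumForm hv h₀ he x⟩, fun n j ωM hj hv hs he x =>
    ⟨pointCocycleDefined_sumForm hv _ hs he x,
      pointCocycleNontrivial_sumForm hv (stdSymplecticPow_ne_zero hj) he x⟩⟩
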